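/- For $n\ge 1$ let $\Sigma_n$ be the symmetric group on $\{1,\dots,n\}$ and let $B_n$ be the braid group with Artin generators $\sigma_1,\dots,\sigma_{n-1}$. Let $SG_n$ be the singular braid group, that is, the group with generators $\sigma_1,\dots,\sigma_{n-1}$ and (if $n\ge2$) $\tau_1$ and with defining relations $$\sigma_j\sigma_{j+1}\sigma_j=\sigma_{j+1}\sigma_j\sigma_{j+1},\qquad \sigma_j\sigma_k=\sigma_k\sigma_j\ (k>j+1),\qquad \sigma_j\tau_1=\tau_1\sigma_j\ (j\neq 2),$$ $$\sigma_2\sigma_1^2\sigma_2\tau_1=\tau_1\sigma_2\sigma_1^2\sigma_2\ (n>2),\qquad \sigma_2\sigma_3\sigma_1\sigma_2\tau_1\sigma_2\sigma_3\sigma_1\sigma_2\tau_1=\tau_1\sigma_2\sigma_3\sigma_1\sigma_2\tau_1\sigma_2\sigma_3\sigma_1\sigma_2\ (n>3).$$ Put $\tau_{j+1}=\sigma_j\sigma_{j+1}\tau_j\sigma_{j+1}^{-1}\sigma_j^{-1}$ for $1\le j\le n-2$. Let $SG_n\to\Sigma_n$ and $B_n\to\Sigma_n$ be the homomorphisms with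 $\sigma_j\mapsto(j\ \,j+1)$ and $\tau_j\mapsto(j\ \,j+1)$. For $0\le i\le n-1$ let $SGD_{n,i}\subset SG_n$ and $D_{n,i}\subset B_n$ be the preimages of the group $\mathrm{Sym}(\{i+1,\dots,n\})\subset\Sigma_n$ of permutations fixing $1,\dots,i$, and let $P_n=\ker(B_n\to\Sigma_n)$ be the pure braid group. Consider the elements $$a_{k,j}=\sigma_k\cdots\sigma_{j-1}\sigma_j^2\sigma_{j-1}^{-1}\cdots\sigma_k^{-1}\quad(1\le k\le j\le n-1,\ k\le i),$$ $$X_{k,j}=\sigma_j\sigma_{j-1}\cdots\sigma_k\,\tau_k\,\sigma_{k+1}^{-1}\cdots\sigma_j^{-1}\quad(1\le k\le j\le i).$$ **Proposition.** For all $0\le i\le n-1$ the group $SGD_{n,i}$ has a presentation in the generators $a_{k,j}$ and $X_{k,j}$ (with indices as above), $\sigma_{i+1},\dots,\sigma_{n-1}$ and, if $i\le n-2$, $\tau_{i+1}$, in which every relator is of one of the following eight forms. Here a *word in $D_{n,i}$* is a word in the generators $a_{k,j}$, $\sigma_{i+1},\dots,\sigma_{n-1}$ and their inverses, and every letter that occurs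 is one of the generators. 1. A word in $D_{n,i}$ that represents $1$ in $B_n$. 2. A defining relator of $SG_{n-i}$ with $\sigma_j$ replaced by $\sigma_{j+i}$ and $\tau_1$ by $\tau_{i+1}$. 3. $X_{k,l}w=wX_{k,l}$, where $k\le l\le i$ and $w$ is a word in $D_{n,i}$ representing an element of $P_n$. 4. $X_{k,l}\sigma_j=\sigma_jX_{k,l}$, where $k\le l\le i$ and $i<j\le n-1$. 5. $X_{k,l}\tau_{i+1}=\tau_{i+1}X_{k,l}$, where $k\le l\le i$. 6. $\tau_{i+1}w=w\tau_{i+1}$, where $w$ is a word in $D_{n,i}$ representing an element of $P_n$. 7. $X_{l,k}\,\sigma_{i+1}\sigma_{i+2}\tau_{i+1}\sigma_{i+2}^{-1}\sigma_{i+1}^{-1}=\sigma_{i+1}\sigma_{i+2}\tau_{i+1}\sigma_{i+2}^{-1}\sigma_{i+1}^{-1}\,X_{l,k}$, where $l\le k\le i$. 8. $X_{k,l}\,wX_{r,s}w^{-1}=wX_{r,s}w^{-1}\,X_{k,l}$, where $k\le l\le i$, $r\le s\le i$, $k<r$ and $w$ is a word in $D_{n,i}$. (Not every relation of these forms holds in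 $SGD_{n,i}$; the relators of the presentation are some of them.) -/

import Mathlib

namespace SingularBraid

/-! Strand positions `1, …, n` are modelled by `Fin n`, the position `p` being the element with
value `p - 1`. Generators `σ_j`, `τ_j` carry their usual indices `1 ≤ j ≤ n - 1`. -/

/-- The transposition `(j  j+1)` in the symmetric group `Σ_n` for `1 ≤ j < n`. -/
def transposition (n j : ℕ) (h : 1 ≤ j ∧ j < n) : Equiv.Perm (Fin n) :=
  Equiv.swap ⟨j - 1, by omega⟩ ⟨j, h.2⟩

/-- The word of the equation `u = v`. -/
def rel {G : Type*} [Group G] (u v : G) : G := u * v⁻¹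

/-- `s_k s_{k+1} ⋯ s_{j-1}`. -/
def ascending {G : Type*} [Group G] (s : ℕ → G) (k j : ℕ) : G :=
  ((List.range' k (j - k)).map s).prod

/-- `s_j s_{j-1} ⋯ s_{k+1}`. -/
def descending {G : Type*} [Group G] (s : ℕ → G) (k j : ℕ) : G :=
  ((List.range' (k + 1) (j - k)).reverse.map s).prod

/-- `a_{k,j} = s_k ⋯ s_{j-1} s_j² s_{j-1}⁻¹ ⋯ s_k⁻¹`. -/
def aElt {G : Type*} [Group G] (s : ℕ → G) (k j : ℕ) : G :=
  ascending s k j * s j ^ 2 * (ascending s k j)⁻¹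

/-- `X_{k,j} = s_j s_{j-1} ⋯ s_k t_k s_{k+1}⁻¹ ⋯ s_{j-1}⁻¹ s_j⁻¹`. -/
def xElt {G : Type*} [Group G] (s t : ℕ → G) (k j : ℕ) : G :=
  descending s k j * (s k * t k) * (descending s k j)⁻¹

/-! ### The braid group -/

/-- The generators `σ_1, …, σ_{n-1}` of the braid group. -/
inductive BraidGen (n : ℕ) : Type
  | sigma (j : ℕ) (h : 1 ≤ j ∧ j < n)

/-- The letter `σ_j` (used only for `1 ≤ j < n`, and set to `1` for other `j`). -/
def BraidGen.word (n j : ℕ) : FreeGroup (BraidGen n) :=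
  if h : 1 ≤ j ∧ j < n then FreeGroup.of (.sigma j h) else 1

/-- Artin's relators of the braid group `B_n`. -/
inductive BraidRel (n : ℕ) : FreeGroup (BraidGen n) → Prop
  | braid (j : ℕ) (h₁ : 1 ≤ j) (h₂ : j + 1 < n) :
      BraidRel n (rel (BraidGen.word n j * BraidGen.word n (j + 1) * BraidGen.word n j)
        (BraidGen.word n (j + 1) * BraidGen.word n j * BraidGen.word n (j + 1)))
  | comm (j k : ℕ) (h₁ : 1 ≤ j) (h₂ : j + 1 < k) (h₃ : k < n) :
      BraidRel n (rel (BraidGen.word n j * BraidGen.word n k)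
        (BraidGen.word n k * BraidGen.word n j))

/-- The braid group `B_n`. -/
abbrev B (n : ℕ) : Type := PresentedGroup {r | BraidRel n r}

/-- The element `σ_j` of `B_n`. -/
def B.sigma (n j : ℕ) : B n := PresentedGroup.mk _ (BraidGen.word n j)

/-! ### The singular braid group -/

/-- The generators `σ_1, …, σ_{n-1}` and (if `n ≥ 2`) `τ_1` of the singular braid group. -/
inductive SingGen (n : ℕ) : Type
  | sigma (j : ℕ) (h : 1 ≤ j ∧ j < n)
  | tau (h : 1 < n)

/-- The letter `σ_j` (used only for `1 ≤ j < n`, and set to `1` for other `j`). -/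
def SingGen.word (n j : ℕ) : FreeGroup (SingGen n) :=
  if h : 1 ≤ j ∧ j < n then FreeGroup.of (.sigma j h) else 1

/-- The letter `τ_1` (used only for `n ≥ 2`, and set to `1` for `n ≤ 1`). -/
def SingGen.tauWord (n : ℕ) : FreeGroup (SingGen n) :=
  if h : 1 < n then FreeGroup.of (.tau h) else 1

/-- The defining relators of `SG_n`: the defining relations of the singular braid monoid `SB_n`
on the generators `σ_j^{±1}`, `τ_1`, read as relations of groups. -/
inductive SingRel (n : ℕ) : FreeGroup (SingGen n) → Prop
  | braid (j : ℕ) (h₁ : 1 ≤ j) (h₂ : j + 1 < n) :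
      SingRel n (rel (SingGen.word n j * SingGen.word n (j + 1) * SingGen.word n j)
        (SingGen.word n (j + 1) * SingGen.word n j * SingGen.word n (j + 1)))
  | comm (j k : ℕ) (h₁ : 1 ≤ j) (h₂ : j + 1 < k) (h₃ : k < n) :
      SingRel n (rel (SingGen.word n j * SingGen.word n k)
        (SingGen.word n k * SingGen.word n j))
  | tau_pure (h : 2 < n) :
      SingRel n (rel
        (SingGen.word n 2 * SingGen.word n 1 ^ 2 * SingGen.word n 2 * SingGen.tauWord n)
        (SingGen.tauWord n * SingGen.word n 2 * SingGen.word n 1 ^ 2 * SingGen.word n 2))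
  | tau_sigma (j : ℕ) (h₁ : 1 ≤ j) (h₂ : j < n) (h₃ : j ≠ 2) :
      SingRel n (rel (SingGen.word n j * SingGen.tauWord n)
        (SingGen.tauWord n * SingGen.word n j))
  | tau_tau (h : 3 < n) :
      SingRel n (rel
        (SingGen.word n 2 * SingGen.word n 3 * SingGen.word n 1 * SingGen.word n 2
          * SingGen.tauWord n
          * SingGen.word n 2 * SingGen.word n 3 * SingGen.word n 1 * SingGen.word n 2
          * SingGen.tauWord n)
        (SingGen.tauWord n
          * SingGen.word n 2 * SingGen.word n 3 * SingGen.word n 1 * SingGen.word n 2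
          * SingGen.tauWord n
          * SingGen.word n 2 * SingGen.word n 3 * SingGen.word n 1 * SingGen.word n 2))

/-- The singular braid group `SG_n`. -/
abbrev SG (n : ℕ) : Type := PresentedGroup {r | SingRel n r}

/-- The element `σ_j` of `SG_n`. -/
def SG.sigma (n j : ℕ) : SG n := PresentedGroup.mk _ (SingGen.word n j)

/-- The element `τ_j` of `SG_n`, with
`τ_{j+1} = σ_j σ_{j+1} τ_j σ_{j+1}⁻¹ σ_j⁻¹` (used only for `1 ≤ j < n`). -/
def SG.tau (n : ℕ) : ℕ → SG n
  | 0 => 1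
  | 1 => PresentedGroup.mk _ (SingGen.tauWord n)
  | j + 2 => SG.sigma n (j + 1) * SG.sigma n (j + 2) * SG.tau n (j + 1)
      * (SG.sigma n (j + 2))⁻¹ * (SG.sigma n (j + 1))⁻¹

/-! ### The homomorphisms to the symmetric group -/

/-- `σ_j ↦ (j  j+1)`. -/
def BraidGen.perm (n : ℕ) : BraidGen n → Equiv.Perm (Fin n)
  | .sigma j h => transposition n j h

/-- `σ_j ↦ (j  j+1)`, `τ_1 ↦ (1  2)`. -/
def SingGen.perm (n : ℕ) : SingGen n → Equiv.Perm (Fin n)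
  | .sigma j h => transposition n j h
  | .tau h => transposition n 1 ⟨le_rfl, h⟩

theorem transposition_sq (n j : ℕ) (h : 1 ≤ j ∧ j < n) :
    transposition n j h * transposition n j h = 1 := Equiv.swap_mul_self _ _

theorem transposition_comm (n j k : ℕ) (hj : 1 ≤ j ∧ j < n) (hk : 1 ≤ k ∧ k < n)
    (hjk : j + 1 < k) :
    transposition n j hj * transposition n k hk
      = transposition n k hk * transposition n j hj := by
  apply Equiv.Perm.Disjoint.commute
  apply Equiv.Perm.disjoint_swap_swap
  simp [Fin.ext_iff]
  omega

theorem transposition_braid (n j : ℕ) (hj : 1 ≤ j ∧ j < n) (hk : 1 ≤ j + 1 ∧ j + 1 < n) :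
    transposition n j hj * transposition n (j + 1) hk * transposition n j hj
      = transposition n (j + 1) hk * transposition n j hj * transposition n (j + 1) hk := by
  ext x
  simp only [transposition, Equiv.Perm.mul_apply, Equiv.swap_apply_def, Fin.ext_iff]
  grind

theorem BraidGen.lift_rel (n : ℕ) :
    ∀ r ∈ {r | BraidRel n r}, FreeGroup.lift (BraidGen.perm n) r = 1 := by
  rintro r (⟨j, h₁, h₂⟩ | ⟨j, k, h₁, h₂, h₃⟩)
  · have e1 : 1 ≤ j ∧ j < n := by omega
    have e2 : 1 ≤ j + 1 ∧ j + 1 < n := by omega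
    simp only [rel, map_mul, map_inv, BraidGen.word, dif_pos e1, dif_pos e2,
      FreeGroup.lift_apply_of, BraidGen.perm]
    rw [mul_inv_eq_one]
    exact transposition_braid n j e1 e2
  · have e1 : 1 ≤ j ∧ j < n := by omega
    have e2 : 1 ≤ k ∧ k < n := by omega
    simp only [rel, map_mul, map_inv, BraidGen.word, dif_pos e1, dif_pos e2,
      FreeGroup.lift_apply_of, BraidGen.perm]
    rw [mul_inv_eq_one]
    exact transposition_comm n j k e1 e2 h₂

theorem SingGen.lift_rel (n : ℕ) :
    ∀ r ∈ {r | SingRel n r}, FreeGroup.lift (SingGen.perm n) r = 1 := by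
  rintro r (⟨j, h₁, h₂⟩ | ⟨j, k, h₁, h₂, h₃⟩ | ⟨h⟩ | ⟨j, h₁, h₂, h₃⟩ | ⟨h⟩)
  · have e1 : 1 ≤ j ∧ j < n := by omega
    have e2 : 1 ≤ j + 1 ∧ j + 1 < n := by omega
    simp only [rel, map_mul, map_inv, SingGen.word, dif_pos e1, dif_pos e2,
      FreeGroup.lift_apply_of, SingGen.perm]
    rw [mul_inv_eq_one]
    exact transposition_braid n j e1 e2
  · have e1 : 1 ≤ j ∧ j < n := by omega
    have e2 : 1 ≤ k ∧ k < n := by omega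
    simp only [rel, map_mul, map_inv, SingGen.word, dif_pos e1, dif_pos e2,
      FreeGroup.lift_apply_of, SingGen.perm]
    rw [mul_inv_eq_one]
    exact transposition_comm n j k e1 e2 h₂
  · have e1 : 1 ≤ 1 ∧ 1 < n := by omega
    have e2 : 1 ≤ 2 ∧ 2 < n := by omega
    simp only [rel, map_mul, map_inv, SingGen.word, SingGen.tauWord, dif_pos e1, dif_pos e2,
      dif_pos e1.2, FreeGroup.lift_apply_of, SingGen.perm, pow_two]
    rw [mul_inv_eq_one]
    simp only [transposition_sq, mul_one, mul_assoc, one_mul]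
  · have e1 : 1 ≤ 1 ∧ 1 < n := by omega
    have e2 : 1 ≤ j ∧ j < n := by omega
    simp only [rel, map_mul, map_inv, SingGen.word, SingGen.tauWord, dif_pos e2,
      dif_pos e1.2, FreeGroup.lift_apply_of, SingGen.perm]
    rw [mul_inv_eq_one]
    rcases Nat.lt_or_ge j 2 with hj | hj
    · obtain rfl : j = 1 := by omega
      rfl
    · exact (transposition_comm n 1 j e1 e2 (by omega)).symm
  · have e1 : 1 ≤ 1 ∧ 1 < n := by omega
    have e2 : 1 ≤ 2 ∧ 2 < n := by omega
    have e3 : 1 ≤ 3 ∧ 3 < n := by omega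
    simp only [rel, map_mul, map_inv, SingGen.word, SingGen.tauWord, dif_pos e1, dif_pos e2,
      dif_pos e3, dif_pos e1.2, FreeGroup.lift_apply_of, SingGen.perm]
    rw [mul_inv_eq_one]
    ext x
    simp only [transposition, Equiv.Perm.mul_apply, Equiv.swap_apply_def, Fin.ext_iff]
    grind

/-- The natural homomorphism `B_n → Σ_n`. -/
def B.perm (n : ℕ) : B n →* Equiv.Perm (Fin n) := PresentedGroup.toGroup (BraidGen.lift_rel n)

/-- The natural homomorphism `SG_n → Σ_n`. -/
def SG.perm (n : ℕ) : SG n →* Equiv.Perm (Fin n) := PresentedGroup.toGroup (SingGen.lift_rel n)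

/-- The pure braid group `P_n`. -/
def P (n : ℕ) : Subgroup (B n) := (B.perm n).ker

/-- The subgroup `Σ_{n-i} = Sym({i+1, …, n})` of `Σ_n`: the permutations fixing `1, …, i`. -/
def symTail (n i : ℕ) : Subgroup (Equiv.Perm (Fin n)) :=
  fixingSubgroup (Equiv.Perm (Fin n)) {p : Fin n | (p : ℕ) < i}

/-- The subgroup `SGD_{n,i}` of `SG_n`. -/
def SGD (n i : ℕ) : Subgroup (SG n) := (symTail n i).comap (SG.perm n)

/-! ### The generators of `D_{n,i}` and of `SGD_{n,i}` -/

/-- The symbols `a_{k,j}` (`1 ≤ k ≤ j ≤ n-1`, `k ≤ i`) and `σ_{i+1}, …, σ_{n-1}`. -/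
inductive DGen (n i : ℕ) : Type
  | a (k j : ℕ) (h : 1 ≤ k ∧ k ≤ j ∧ j < n ∧ k ≤ i)
  | sigma (j : ℕ) (h : i < j ∧ j < n)

/-- The symbols `a_{k,j}`, `σ_{i+1}, …, σ_{n-1}`, `X_{k,j}` (`1 ≤ k ≤ j ≤ i`) and
(if `i + 1 ≤ n - 1`) `τ_{i+1}`. -/
inductive SGDGen (n i : ℕ) : Type
  | braid (d : DGen n i)
  | X (k j : ℕ) (h : 1 ≤ k ∧ k ≤ j ∧ j ≤ i)
  | tau (h : i + 1 < n)

/-- The braid denoted by a symbol of `DGen n i`. -/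
def DGen.toB {n i : ℕ} : DGen n i → B n
  | .a k j _ => aElt (B.sigma n) k j
  | .sigma j _ => B.sigma n j

/-- The element of `SG_n` denoted by a symbol of `SGDGen n i`. -/
def SGDGen.toSG {n i : ℕ} : SGDGen n i → SG n
  | .braid (.a k j _) => aElt (SG.sigma n) k j
  | .braid (.sigma j _) => SG.sigma n j
  | .X k j _ => xElt (SG.sigma n) (SG.tau n) k j
  | .tau _ => SG.tau n (i + 1)

/-- The braid represented by a word in the generators of `D_{n,i}`. -/
def evalB {n i : ℕ} : FreeGroup (DGen n i) →* B n := FreeGroup.lift DGen.toB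

/-- A word in the generators of `D_{n,i}`, as a word in the generators of `SGD_{n,i}`. -/
def inclD {n i : ℕ} : FreeGroup (DGen n i) →* FreeGroup (SGDGen n i) :=
  FreeGroup.map SGDGen.braid

/-- On generators, `φ_{n,i} : SG_{n-i} → SGD_{n,i}`, `σ_j ↦ σ_{j+i}`, `τ_1 ↦ τ_{i+1}`. -/
def phiGen {n i : ℕ} : SingGen (n - i) → SGDGen n i
  | .sigma j h => .braid (.sigma (j + i) (by omega))
  | .tau h => .tau (by omega)

/-- The letter `σ_j` of the generators of `SGD_{n,i}`. -/
def sLetter {n i : ℕ} (j : ℕ) (h : i < j ∧ j < n) : FreeGroup (SGDGen n i) :=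
  FreeGroup.of (.braid (.sigma j h))

/-- The letter `X_{k,j}`. -/
def xLetter {n i : ℕ} (k j : ℕ) (h : 1 ≤ k ∧ k ≤ j ∧ j ≤ i) : FreeGroup (SGDGen n i) :=
  FreeGroup.of (.X k j h)

/-- The letter `τ_{i+1}`. -/
def tLetter {n i : ℕ} (h : i + 1 < n) : FreeGroup (SGDGen n i) := FreeGroup.of (.tau h)

/-- The word of the relation `u v = v u`. -/
def commRel {G : Type*} [Group G] (u v : G) : G := rel (u * v) (v * u)

/-- The eight forms of relators. -/
inductive RelatorForm (n i : ℕ) : FreeGroup (SGDGen n i) → Prop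
  /-- relators coming from `D_{n,i} ⊆ B_n` -/
  | fromD (w : FreeGroup (DGen n i)) (hw : evalB w = 1) : RelatorForm n i (inclD w)
  /-- relators of `SG_{n-i}`, carried over by `φ_{n,i}` -/
  | fromSG (r : FreeGroup (SingGen (n - i))) (hr : SingRel (n - i) r) :
      RelatorForm n i (FreeGroup.map phiGen r)
  /-- `X_{k,l} w = w X_{k,l}` with `w ∈ P_n` -/
  | X_pure (k l : ℕ) (h : 1 ≤ k ∧ k ≤ l ∧ l ≤ i) (w : FreeGroup (DGen n i))
      (hw : evalB w ∈ P n) : RelatorForm n i (commRel (xLetter k l h) (inclD w))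
  /-- `X_{k,l} σ_j = σ_j X_{k,l}` -/
  | X_sigma (k l : ℕ) (h : 1 ≤ k ∧ k ≤ l ∧ l ≤ i) (j : ℕ) (hj : i < j ∧ j < n) :
      RelatorForm n i (commRel (xLetter k l h) (sLetter j hj))
  /-- `X_{k,l} τ_{i+1} = τ_{i+1} X_{k,l}` -/
  | X_tau (k l : ℕ) (h : 1 ≤ k ∧ k ≤ l ∧ l ≤ i) (hi : i + 1 < n) :
      RelatorForm n i (commRel (xLetter k l h) (tLetter hi))
  /-- `τ_{i+1} w = w τ_{i+1}` with `w ∈ P_n` -/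
  | tau_pure (hi : i + 1 < n) (w : FreeGroup (DGen n i)) (hw : evalB w ∈ P n) :
      RelatorForm n i (commRel (tLetter hi) (inclD w))
  /-- `X_{l,k}` commutes with `σ_{i+1} σ_{i+2} τ_{i+1} σ_{i+2}⁻¹ σ_{i+1}⁻¹` -/
  | X_tau_conj (l k : ℕ) (h : 1 ≤ l ∧ l ≤ k ∧ k ≤ i) (hi : i + 2 < n) :
      RelatorForm n i (commRel (xLetter l k h)
        (sLetter (i + 1) (by omega) * sLetter (i + 2) (by omega) * tLetter (by omega)
          * (sLetter (i + 2) (by omega))⁻¹ * (sLetter (i + 1) (by omega))⁻¹))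
  /-- `X_{k,l}` commutes with `w X_{r,s} w⁻¹`, where `k < r` and `w` is a word in `D_{n,i}` -/
  | X_X_conj (k l r s : ℕ) (h : 1 ≤ k ∧ k ≤ l ∧ l ≤ i) (h' : 1 ≤ r ∧ r ≤ s ∧ s ≤ i)
      (hkr : k < r) (w : FreeGroup (DGen n i)) :
      RelatorForm n i (commRel (xLetter k l h) (inclD w * xLetter r s h' * (inclD w)⁻¹))

end SingularBraid

/-! Put ζ = σ_1 τ_1 and g = σ_2 σ_3 σ_1 σ_2. Since τ_1 = σ_1⁻¹ ζ, the group SG_n is generated by the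
braids and the conjugates of ζ by braids, and all these conjugates have trivial permutation. The
relations with a single τ_1 say that certain braids commute with ζ; the relation with two letters
τ_1 on each side says that ζ commutes with g ζ g⁻¹. Let `tauStab` be the group of braids that
commute with σ_1 and with τ_1. It need not be known explicitly. A conjugate of ζ depends only on a
coset of `tauStab`, called a vertex; the vertices of b and b g are called adjacent. Let V be the
group generated by the vertices in which adjacent vertices commute. There is a homomorphism from
SG_n to V ⋊ B_n that sends each conjugate of ζ to its vertex (`SG.toSemiProd`).

As relators take all words of the eight forms that hold in SG_n. The presented group `Pres` then
maps to SG_n, and the claim is that this map is injective with image SGD_{n,i}. For this a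
surjection V ⋊ D_{n,i} → `Pres` is constructed. The composite V ⋊ D_{n,i} → `Pres` → SG_n → V ⋊ B_n
is the inclusion, so nothing is lost in `Pres` (`Pres.toSG_injective`).

On D_{n,i} the surjection comes from form 1, because the braids a_{k,j} and σ_j generate D_{n,i}
(`D_le_range_evalB`). A vertex has an unordered pair of strands, and this pair up to the
permutations of the last n - i strands classifies the D_{n,i}-orbits of vertices. The orbits have
representatives belonging to the X_{k,j} and to σ_{i+1} τ_{i+1}. The element of a vertex is obtained
by conjugation from its representative; it is well defined because stabilizers commute with the
representatives (`fromD_commute_repElt`). Here an element of the stabilizer is reduced to a pure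
braid times a braid on the last strands, and forms 2, 3, 4 and 6 apply. Finally adjacent vertices
have commuting elements (`Adj.commute_vertexElt`): form 8 if both vertices use one of the first i
strands, forms 4, 5 and 7 if exactly one does, form 2 if neither does. -/

namespace SingularBraid

/-! ### Ascending and descending products -/

section Products

variable {G : Type*} [Group G] (s : ℕ → G)

theorem ascending_self (k : ℕ) : ascending s k k = 1 := by simp [ascending]

theorem ascending_succ {k j : ℕ} (h : k ≤ j) :
    ascending s k (j + 1) = ascending s k j * s j := by
  have e : j + 1 - k = (j - k) + 1 := by omega
  have e' : k + (j - k) = j := by omega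
  simp [ascending, e, List.range'_1_concat, e']

theorem ascending_mul {k j l : ℕ} (h : k ≤ j) (h' : j ≤ l) :
    ascending s k j * ascending s j l = ascending s k l := by
  induction l, h' using Nat.le_induction with
  | base => simp [ascending_self]
  | succ l hl ih => rw [ascending_succ s hl, ascending_succ s (h.trans hl), ← mul_assoc, ih]

theorem descending_self (k : ℕ) : descending s k k = 1 := by simp [descending]

theorem descending_succ {k j : ℕ} (h : k ≤ j) :
    descending s k (j + 1) = s (j + 1) * descending s k j := by
  have e : j + 1 - k = (j - k) + 1 := by omega
  have e' : k + 1 + (j - k) = j + 1 := by omega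
  simp [descending, e, List.range'_1_concat, e']

theorem Commute.ascending_right {x : G} {k j : ℕ} (h : ∀ m, k ≤ m → m < j → Commute x (s m)) :
    Commute x (ascending s k j) := by
  rcases le_total j k with hk | hk
  · simp [ascending, Nat.sub_eq_zero_of_le hk]
  induction j, hk using Nat.le_induction with
  | base => simp [ascending_self]
  | succ j hj ih =>
    rw [ascending_succ s hj]
    exact (ih fun m h₁ h₂ => h m h₁ (by omega)).mul_right (h j hj (by omega))

theorem descending_mem (H : Subgroup G) {k j : ℕ} (h : ∀ m, k < m → m ≤ j → s m ∈ H) :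
    descending s k j ∈ H := by
  apply Subgroup.list_prod_mem
  intro x hx
  simp only [List.mem_map, List.mem_reverse, List.mem_range'_1] at hx
  obtain ⟨m, hm, rfl⟩ := hx
  exact h m (by omega) (by omega)

theorem map_ascending {H : Type*} [Group H] (f : G →* H) (k j : ℕ) :
    f (ascending s k j) = ascending (fun m => f (s m)) k j := by
  simp [ascending, map_list_prod, Function.comp_def]

theorem map_descending {H : Type*} [Group H] (f : G →* H) (k j : ℕ) :
    f (descending s k j) = descending (fun m => f (s m)) k j := by
  simp [descending, map_list_prod, Function.comp_def]

end Products

/-! ### Consequences of one braid relation -/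

section ThreeStrands

variable {G : Type*} [Group G] {a b : G}

theorem braid_conj_sq (h : a * b * a = b * a * b) :
    b⁻¹ * a ^ 2 * b = a * b ^ 2 * a⁻¹ := by
  have h1 : a * b * a⁻¹ = b⁻¹ * a * b := by
    rw [mul_inv_eq_iff_eq_mul, mul_assoc b⁻¹, mul_assoc b⁻¹, eq_inv_mul_iff_mul_eq, ← mul_assoc, h]
  calc b⁻¹ * a ^ 2 * b = (b⁻¹ * a * b) ^ 2 := by simp [pow_two, mul_assoc]
    _ = a * b ^ 2 * a⁻¹ := by rw [← h1]; simp [pow_two, mul_assoc]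

/-- With a = σ_j and b = σ_{j+1}, this expresses the conjugate of a_{k,j} by σ_{j+1} through a_{k,j}
and a_{k,j+1}. -/
theorem braid_conj_sq' (h : a * b * a = b * a * b) :
    b * a ^ 2 * b⁻¹ = (a ^ 2)⁻¹ * (a * b ^ 2 * a⁻¹) * a ^ 2 := by
  have := braid_conj_sq h.symm
  rw [← this]
  simp [pow_two, mul_assoc]

end ThreeStrands

/-! ### Braids -/

theorem B.sigma_of_not {n j : ℕ} (h : ¬ (1 ≤ j ∧ j < n)) : B.sigma n j = 1 := by
  simp [B.sigma, BraidGen.word, h]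

theorem B.sigma_braid {n j : ℕ} (h₁ : 1 ≤ j) (h₂ : j + 1 < n) :
    B.sigma n j * B.sigma n (j + 1) * B.sigma n j
      = B.sigma n (j + 1) * B.sigma n j * B.sigma n (j + 1) := by
  have := PresentedGroup.one_of_mem (rels := {r | BraidRel n r}) (BraidRel.braid j h₁ h₂)
  rw [rel, map_mul, map_inv, mul_inv_eq_one, map_mul, map_mul, map_mul, map_mul] at this
  exact this

theorem B.sigma_comm {n j k : ℕ} (h : j + 1 < k) : Commute (B.sigma n j) (B.sigma n k) := by
  by_cases hj : 1 ≤ j ∧ k < n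
  · have := PresentedGroup.one_of_mem (rels := {r | BraidRel n r}) (BraidRel.comm j k hj.1 h hj.2)
    rw [rel, map_mul, map_inv, mul_inv_eq_one, map_mul, map_mul] at this
    exact this
  · rcases not_and_or.1 hj with hj | hj
    · rw [B.sigma_of_not (by omega)]; exact Commute.one_left _
    · rw [B.sigma_of_not (j := k) (by omega)]; exact Commute.one_right _

/-- The factors after σ_m σ_{m+1} commute with σ_m, those before it commute with σ_{m+1}, and the
braid relation does the rest. -/
theorem B.ascending_mul_sigma {n k j m : ℕ} (hk : 1 ≤ k) (hm : k ≤ m) (hj : m + 1 < j)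
    (hn : j ≤ n) :
    ascending (B.sigma n) k j * B.sigma n m = B.sigma n (m + 1) * ascending (B.sigma n) k j := by
  have e : ascending (B.sigma n) k j = ascending (B.sigma n) k m
      * (B.sigma n m * B.sigma n (m + 1)) * ascending (B.sigma n) (m + 2) j := by
    rw [← mul_assoc, ← ascending_succ _ hm, ← ascending_succ _ (by omega),
      ascending_mul _ (by omega) (by omega)]
  have h1 : Commute (B.sigma n m) (ascending (B.sigma n) (m + 2) j) :=
    Commute.ascending_right _ fun p h₁ h₂ => B.sigma_comm (by omega)
  have h2 : Commute (B.sigma n (m + 1)) (ascending (B.sigma n) k m) :=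
    Commute.ascending_right _ fun p h₁ h₂ => (B.sigma_comm (by omega)).symm
  have h3 := B.sigma_braid (n := n) (j := m) (by omega) (by omega)
  rw [e]
  calc _ = ascending (B.sigma n) k m * (B.sigma n m * B.sigma n (m + 1) * B.sigma n m)
        * ascending (B.sigma n) (m + 2) j := by
        rw [mul_assoc, ← h1.eq]; simp only [mul_assoc]
    _ = (ascending (B.sigma n) k m * B.sigma n (m + 1)) * (B.sigma n m * B.sigma n (m + 1))
        * ascending (B.sigma n) (m + 2) j := by rw [h3]; simp only [mul_assoc]
    _ = _ := by rw [← h2.eq]; simp only [mul_assoc]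

theorem B.closure_sigma (n : ℕ) :
    Subgroup.closure {b | ∃ j, 1 ≤ j ∧ j < n ∧ b = B.sigma n j} = ⊤ := by
  rw [eq_top_iff, ← PresentedGroup.closure_range_of, Subgroup.closure_le]
  rintro _ ⟨⟨j, h⟩, rfl⟩
  apply Subgroup.subset_closure
  refine ⟨j, h.1, h.2, ?_⟩
  rw [B.sigma, BraidGen.word, dif_pos h]
  rfl

/-! ### Braids as permutations of `ℕ` -/

/-- The permutation of a braid, extended to `ℕ` by the identity. -/
def B.natPerm (n : ℕ) : B n →* Equiv.Perm ℕ :=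
  (Equiv.Perm.extendDomainHom Fin.equivSubtype).comp (B.perm n)

theorem B.natPerm_apply_fin {n : ℕ} (b : B n) (x : Fin n) :
    B.natPerm n b x = B.perm n b x :=
  Equiv.Perm.extendDomain_apply_image (B.perm n b) Fin.equivSubtype x

theorem B.natPerm_of_le {n x : ℕ} (b : B n) (h : n ≤ x) : B.natPerm n b x = x :=
  Equiv.Perm.extendDomain_apply_not_subtype (B.perm n b) Fin.equivSubtype (by omega)

theorem B.natPerm_lt {n x : ℕ} (b : B n) (h : x < n) : B.natPerm n b x < n := by
  have := B.natPerm_apply_fin b ⟨x, h⟩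
  simp only at this
  rw [this]
  exact Fin.is_lt _

theorem B.perm_sigma {n j : ℕ} (h : 1 ≤ j ∧ j < n) :
    B.perm n (B.sigma n j) = transposition n j h := by
  rw [B.sigma, BraidGen.word, dif_pos h]
  exact PresentedGroup.toGroup.of _

theorem B.natPerm_sigma {n j : ℕ} (h : 1 ≤ j ∧ j < n) :
    B.natPerm n (B.sigma n j) = Equiv.swap (j - 1) j := by
  ext x
  rcases lt_or_ge x n with hx | hx
  · have := B.natPerm_apply_fin (B.sigma n j) ⟨x, hx⟩
    simp only at this
    rw [this, B.perm_sigma h, transposition]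
    simp only [Equiv.swap_apply_def, Fin.ext_iff]
    split_ifs <;> rfl
  · rw [B.natPerm_of_le _ hx, Equiv.swap_apply_of_ne_of_ne] <;> omega

theorem B.mem_P {n : ℕ} {b : B n} : b ∈ P n ↔ B.natPerm n b = 1 := by
  rw [P, MonoidHom.mem_ker, B.natPerm, MonoidHom.comp_apply,
    map_eq_one_iff _ (Equiv.Perm.extendDomainHom_injective _)]

/-- The subgroup `D_{n,i}` of `B_n`. -/
def D (n i : ℕ) : Subgroup (B n) := (symTail n i).comap (B.perm n)

theorem mem_D {n i : ℕ} {b : B n} : b ∈ D n i ↔ ∀ x < i, B.natPerm n b x = x := by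
  rw [D, Subgroup.mem_comap, symTail, mem_fixingSubgroup_iff]
  constructor
  · intro h x hx
    rcases lt_or_ge x n with hn | hn
    · have := B.natPerm_apply_fin b ⟨x, hn⟩
      simp only at this
      rw [this]
      exact congrArg Fin.val (h ⟨x, hn⟩ hx)
    · exact B.natPerm_of_le b hn
  · intro h x hx
    apply Fin.ext
    rw [Equiv.Perm.smul_def, ← B.natPerm_apply_fin]
    exact h x hx

/-- The subgroup generated by `σ_j` for `m < j`. -/
def tailBraids (n m : ℕ) : Subgroup (B n) :=
  Subgroup.closure {b | ∃ j, m < j ∧ j < n ∧ b = B.sigma n j}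

theorem sigma_mem_tailBraids {n m j : ℕ} (h : m < j) : B.sigma n j ∈ tailBraids n m := by
  by_cases hj : j < n
  · exact Subgroup.subset_closure ⟨j, h, hj, rfl⟩
  · rw [B.sigma_of_not (by omega)]; exact one_mem _

theorem tailBraids_le {n m : ℕ} {H : Subgroup (B n)}
    (h : ∀ j, m < j → j < n → B.sigma n j ∈ H) : tailBraids n m ≤ H := by
  rw [tailBraids, Subgroup.closure_le]
  rintro _ ⟨j, h₁, h₂, rfl⟩
  exact h j h₁ h₂

theorem tailBraids_anti {n m m' : ℕ} (h : m ≤ m') : tailBraids n m' ≤ tailBraids n m :=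
  tailBraids_le fun _ h₁ _ => sigma_mem_tailBraids (by omega)

theorem sigma_mem_D {n i j : ℕ} (h : i < j) : B.sigma n j ∈ D n i := by
  by_cases hj : j < n
  · rw [mem_D]
    intro x hx
    rw [B.natPerm_sigma (by omega), Equiv.swap_apply_of_ne_of_ne] <;> omega
  · rw [B.sigma_of_not (by omega)]; exact one_mem _

theorem tailBraids_le_D (n i : ℕ) : tailBraids n i ≤ D n i :=
  tailBraids_le fun _ h₁ _ => sigma_mem_D h₁

theorem exists_tailBraids_apply {n m y : ℕ} (h : m ≤ y) (hy : y < n) :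
    ∃ c ∈ tailBraids n m, B.natPerm n c m = y := by
  induction y, h using Nat.le_induction with
  | base => exact ⟨1, one_mem _, by simp⟩
  | succ y h ih =>
    obtain ⟨c, hc, e⟩ := ih (by omega)
    refine ⟨B.sigma n (y + 1) * c, mul_mem (sigma_mem_tailBraids (by omega)) hc, ?_⟩
    rw [map_mul, Equiv.Perm.mul_apply, e, B.natPerm_sigma (by omega)]
    simp

theorem le_natPerm {n m x : ℕ} {b : B n} (hb : b ∈ D n m) (hx : m ≤ x) :
    m ≤ B.natPerm n b x := by
  by_contra! h
  have := mem_D.1 hb _ h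
  rw [(B.natPerm n b).injective this] at h
  omega

/-- Every injection of `{m, …, m + k - 1}` into `{m, …, n - 1}` is induced by a braid on the
last strands. -/
theorem exists_tailBraids_apply_eq {n : ℕ} (k : ℕ) : ∀ (m : ℕ) (f : ℕ → ℕ),
    (∀ x < k, m ≤ f x ∧ f x < n) → Set.InjOn f (Set.Iio k) →
    ∃ c ∈ tailBraids n m, ∀ x < k, B.natPerm n c (m + x) = f x := by
  induction k with
  | zero => exact fun m f _ _ => ⟨1, one_mem _, by simp⟩
  | succ k ih =>
    intro m f hf hinj
    -- `c` carries `m` to `f 0`. The other values, pulled back by `c`, lie above `m`, so by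
    -- induction they are realised by a braid `d` that fixes `m`; the answer is `c * d`.
    obtain ⟨c, hc, e⟩ := exists_tailBraids_apply (hf 0 (by omega)).1 (hf 0 (by omega)).2
    have hc' : c⁻¹ ∈ D n m := inv_mem (tailBraids_le_D n m hc)
    obtain ⟨d, hd, e'⟩ := ih (m + 1) (fun x => B.natPerm n c⁻¹ (f (x + 1))) (by
      intro x hx
      have h1 := hf (x + 1) (by omega)
      refine ⟨?_, B.natPerm_lt _ h1.2⟩
      have h2 := le_natPerm hc' h1.1
      rcases h2.lt_or_eq with h | h
      · exact h
      · have h3 := congrArg (B.natPerm n c) h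
        rw [e, ← Equiv.Perm.mul_apply, ← map_mul, mul_inv_cancel, map_one,
          Equiv.Perm.one_apply] at h3
        have h4 := hinj (Set.mem_Iio.2 (by omega)) (Set.mem_Iio.2 (by omega)) h3
        omega) (by
      intro x hx y hy hxy
      have h3 := hinj (Set.mem_Iio.2 (by simp at hx; omega)) (Set.mem_Iio.2 (by simp at hy; omega))
        ((B.natPerm n c⁻¹).injective hxy)
      omega)
    refine ⟨c * d, mul_mem hc (tailBraids_anti (by omega) hd), ?_⟩
    intro x hx
    rw [map_mul, Equiv.Perm.mul_apply]
    rcases x with _ | x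
    · rw [mem_D.1 (tailBraids_le_D _ _ hd) _ (by omega)]
      exact e
    · rw [show m + (x + 1) = m + 1 + x by omega, e' x (by omega), ← Equiv.Perm.mul_apply,
        ← map_mul, mul_inv_cancel, map_one, Equiv.Perm.one_apply]

/-- A braid of `D_{n,m}` is, up to a pure braid, a braid on the last strands. -/
theorem exists_tailBraids_natPerm {n m : ℕ} {b : B n} (hb : b ∈ D n m) :
    ∃ c ∈ tailBraids n m, B.natPerm n c = B.natPerm n b := by
  obtain ⟨c, hc, e⟩ := exists_tailBraids_apply_eq (n - m) m (fun x => B.natPerm n b (m + x))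
    (fun x hx => ⟨le_natPerm hb (by omega), B.natPerm_lt _ (by omega)⟩)
    (fun x _ y _ hxy => by simpa using (B.natPerm n b).injective hxy)
  refine ⟨c, hc, Equiv.ext fun x => ?_⟩
  rcases lt_or_ge x m with h | h
  · rw [mem_D.1 (tailBraids_le_D _ _ hc) _ h, mem_D.1 hb _ h]
  · obtain ⟨y, rfl⟩ := Nat.exists_eq_add_of_le h
    rcases lt_or_ge (m + y) n with h' | h'
    · exact e y (by omega)
    · rw [B.natPerm_of_le _ h', B.natPerm_of_le _ h']

/-- Two braids whose permutations agree on the first `m` strands up to `d₀ ∈ D_{n,i}`. -/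
theorem exists_eq_mul_mul {n i m : ℕ} {b b' d₀ : B n} (hd : d₀ ∈ D n i)
    (h : ∀ x < m, B.natPerm n b x = B.natPerm n (d₀ * b') x) :
    ∃ d ∈ D n i, ∃ c ∈ tailBraids n m, b = d * b' * c := by
  have h1 : (d₀ * b')⁻¹ * b ∈ D n m := by
    rw [mem_D]
    intro x hx
    rw [map_mul, Equiv.Perm.mul_apply, h x hx, ← Equiv.Perm.mul_apply, ← map_mul, inv_mul_cancel,
      map_one, Equiv.Perm.one_apply]
  obtain ⟨c, hc, e⟩ := exists_tailBraids_natPerm h1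
  -- Since `c` has the permutation of `(d₀ * b')⁻¹ * b`, this braid has the same permutation as
  -- `d₀`, and membership in D_{n,i} depends only on the permutation.
  refine ⟨b * c⁻¹ * b'⁻¹, ?_, c, hc, by group⟩
  have : B.natPerm n (b * c⁻¹ * b'⁻¹) = B.natPerm n d₀ := by
    rw [map_mul, map_mul, map_inv _ c, e, ← map_inv, ← map_mul, ← map_mul]
    congr 1
    group
  rw [mem_D] at hd ⊢
  rwa [this]

/-! ### Generators of `D_{n,i}` -/

theorem aElt_succ {n k j : ℕ} (hk : 1 ≤ k) (hkj : k ≤ j) (hj : j + 1 < n) :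
    aElt (B.sigma n) k (j + 1)
      = (B.sigma n (j + 1))⁻¹ * aElt (B.sigma n) k j * B.sigma n (j + 1) := by
  have h1 := braid_conj_sq (B.sigma_braid (n := n) (hk.trans hkj) hj)
  have h2 : Commute (B.sigma n (j + 1)) (ascending (B.sigma n) k j) :=
    Commute.ascending_right _ fun p h₁ h₂ => (B.sigma_comm (by omega)).symm
  have h3 := h2.inv_left.eq
  have h4 := h2.inv_right.eq
  rw [aElt, aElt, ascending_succ _ hkj]
  calc _ = ascending (B.sigma n) k j * (B.sigma n j * B.sigma n (j + 1) ^ 2 * (B.sigma n j)⁻¹)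
        * (ascending (B.sigma n) k j)⁻¹ := by group
    _ = (ascending (B.sigma n) k j * (B.sigma n (j + 1))⁻¹) * B.sigma n j ^ 2
        * (B.sigma n (j + 1) * (ascending (B.sigma n) k j)⁻¹) := by rw [← h1]; group
    _ = _ := by rw [← h3, h4]; group

/-- The subgroup generated by `a_{k,j}` for all `j`. -/
def strandBraids (n k : ℕ) : Subgroup (B n) :=
  Subgroup.closure {b | ∃ j, k ≤ j ∧ j < n ∧ b = aElt (B.sigma n) k j}

theorem aElt_mem_strandBraids {n k j : ℕ} (h : k ≤ j) (h' : j < n) :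
    aElt (B.sigma n) k j ∈ strandBraids n k := Subgroup.subset_closure ⟨j, h, h', rfl⟩

/-- Conjugation by σ_p fixes a_{k,j} for p < j and for p > j + 1, gives a_{k,j-1} for p = j, and
gives a_{k,j}⁻¹ a_{k,j+1} a_{k,j} for p = j + 1. -/
theorem sigma_conj_aElt {n k j p : ℕ} (hk : 1 ≤ k) (h : k ≤ j) (hj : j < n) (hp : k < p)
    (hpn : p < n) :
    B.sigma n p * aElt (B.sigma n) k j * (B.sigma n p)⁻¹ ∈ strandBraids n k := by
  rcases lt_trichotomy p j with hpj | rfl | hpj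
  · have h1 := B.ascending_mul_sigma (n := n) (k := k) (j := j) (m := p - 1) hk (by omega)
      (by omega) hj.le
    rw [show p - 1 + 1 = p by omega] at h1
    have h2 : Commute (B.sigma n (p - 1)) (B.sigma n j ^ 2) :=
      (B.sigma_comm (by omega)).pow_right 2
    have : B.sigma n p * aElt (B.sigma n) k j * (B.sigma n p)⁻¹ = aElt (B.sigma n) k j := by
      have h3 : B.sigma n p
          = ascending (B.sigma n) k j * B.sigma n (p - 1) * (ascending (B.sigma n) k j)⁻¹ := by
        rw [h1, mul_inv_cancel_right]
      rw [aElt, h3]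
      calc _ = ascending (B.sigma n) k j * (B.sigma n (p - 1) * B.sigma n j ^ 2)
            * (B.sigma n (p - 1))⁻¹ * (ascending (B.sigma n) k j)⁻¹ := by group
        _ = _ := by rw [h2.eq]; group
    rw [this]
    exact aElt_mem_strandBraids h hj
  · obtain ⟨j, rfl⟩ : ∃ j, p = j + 1 := ⟨p - 1, by omega⟩
    rw [aElt_succ hk (by omega) hj]
    convert aElt_mem_strandBraids (n := n) (k := k) (j := j) (by omega) (by omega) using 1
    group
  · rcases eq_or_lt_of_le (Nat.succ_le_of_lt hpj) with rfl | hpj'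
    · have hx := aElt_mem_strandBraids h hj
      have hy := aElt_mem_strandBraids (n := n) (k := k) (j := j + 1) (by omega) hpn
      convert mul_mem (mul_mem (inv_mem hx) hy) hx using 1
      have h1 := braid_conj_sq' (B.sigma_braid (n := n) (hk.trans h) hpn)
      have h2 : Commute (B.sigma n (j + 1)) (ascending (B.sigma n) k j) :=
        Commute.ascending_right _ fun p h₁ h₂ => (B.sigma_comm (by omega)).symm
      have h4 := h2.inv_inv.eq
      rw [aElt, aElt, ascending_succ _ h]
      calc _ = (B.sigma n (j + 1) * ascending (B.sigma n) k j) * B.sigma n j ^ 2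
            * ((ascending (B.sigma n) k j)⁻¹ * (B.sigma n (j + 1))⁻¹) := by simp only [mul_assoc, Nat.succ_eq_add_one]
        _ = ascending (B.sigma n) k j * (B.sigma n (j + 1) * B.sigma n j ^ 2
            * (B.sigma n (j + 1))⁻¹) * (ascending (B.sigma n) k j)⁻¹ := by
          rw [← h4, h2.eq]; simp only [mul_assoc]
        _ = _ := by rw [h1]; group
    · have h1 : Commute (B.sigma n p) (aElt (B.sigma n) k j) := by
        have h2 : Commute (B.sigma n p) (ascending (B.sigma n) k j) :=
          Commute.ascending_right _ fun p h₁ h₂ => (B.sigma_comm (by omega)).symm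
        have h3 : Commute (B.sigma n p) (B.sigma n j) := (B.sigma_comm (by omega)).symm
        exact (h2.mul_right (h3.pow_right 2)).mul_right h2.inv_right
      rw [h1.eq, mul_inv_cancel_right]
      exact aElt_mem_strandBraids h hj

theorem sigma_conj_strandBraids {n k p : ℕ} (hk : 1 ≤ k) (hp : k < p) (hpn : p < n) {x : B n}
    (hx : x ∈ strandBraids n k) : B.sigma n p * x * (B.sigma n p)⁻¹ ∈ strandBraids n k := by
  have : strandBraids n k ≤
      (strandBraids n k).comap (MulAut.conj (B.sigma n p)).toMonoidHom := by
    conv_lhs => rw [strandBraids]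
    rw [Subgroup.closure_le]
    rintro _ ⟨j, h₁, h₂, rfl⟩
    exact sigma_conj_aElt hk h₁ h₂ hp hpn
  exact this hx

theorem ascending_conj_strandBraids {n k p m : ℕ} (hk : 1 ≤ k) (hp : k < p) (hpm : p ≤ m)
    (hm : m ≤ n) {x : B n} (hx : x ∈ strandBraids n k) :
    ascending (B.sigma n) p m * x * (ascending (B.sigma n) p m)⁻¹ ∈ strandBraids n k := by
  induction m, hpm using Nat.le_induction generalizing x with
  | base => simpa [ascending_self] using hx
  | succ m h ih =>
    have := ih (by omega) (sigma_conj_strandBraids hk (by omega : k < m) (by omega) hx)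
    rw [ascending_succ _ h]
    convert this using 1
    group

theorem natPerm_aElt {n k j : ℕ} (h : 1 ≤ j ∧ j < n) :
    B.natPerm n (aElt (B.sigma n) k j) = 1 := by
  simp [aElt, pow_two, B.natPerm_sigma h]

theorem range_evalB (n i : ℕ) :
    (evalB (n := n) (i := i)).range = Subgroup.closure (Set.range (DGen.toB (n := n) (i := i))) :=
  FreeGroup.range_lift_eq_closure

theorem range_evalB_le (n i : ℕ) : (evalB (n := n) (i := i)).range ≤ D n i := by
  rw [range_evalB, Subgroup.closure_le]
  rintro _ ⟨_ | ⟨j, h⟩, rfl⟩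
  · rename_i k j h
    rw [SetLike.mem_coe, mem_D]
    intro x _
    rw [DGen.toB, natPerm_aElt (by omega), Equiv.Perm.one_apply]
  · exact sigma_mem_D h.1

theorem natPerm_ascending_inv {n i m : ℕ} (h : i ≤ m) (hm : m < n) :
    B.natPerm n (ascending (B.sigma n) (i + 1) (m + 1))⁻¹ i = m := by
  induction m, h using Nat.le_induction with
  | base => simp [ascending_self]
  | succ m h ih =>
    rw [ascending_succ _ (by omega), mul_inv_rev, map_mul, Equiv.Perm.mul_apply, ih (by omega),
      map_inv, B.natPerm_sigma (by omega)]
    simp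

theorem aElt_mem_range_evalB {n i k j : ℕ} (h : 1 ≤ k ∧ k ≤ j ∧ j < n ∧ k ≤ i) :
    aElt (B.sigma n) k j ∈ (evalB (n := n) (i := i)).range := by
  rw [range_evalB]
  exact Subgroup.subset_closure ⟨.a k j h, rfl⟩

theorem sigma_mem_range_evalB {n i j : ℕ} (h : i < j ∧ j < n) :
    B.sigma n j ∈ (evalB (n := n) (i := i)).range := by
  rw [range_evalB]
  exact Subgroup.subset_closure ⟨.sigma j h, rfl⟩

theorem strandBraids_le_range_evalB {n i k : ℕ} (hk : 1 ≤ k) (h : k ≤ i) :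
    strandBraids n k ≤ (evalB (n := n) (i := i)).range := by
  rw [strandBraids, Subgroup.closure_le]
  rintro _ ⟨j, h₁, h₂, rfl⟩
  exact aElt_mem_range_evalB ⟨hk, h₁, h₂, h⟩

/-- A generator of `D_{n,i}` permutes the cosets `(σ_{i+1} ⋯ σ_m)⁻¹ D_{n,i+1}`. -/
theorem exists_coset_step {n i m : ℕ} (h : i ≤ m) (hm : m < n) (d : DGen n i) :
    ∃ m', i ≤ m' ∧ m' < n ∧
      ascending (B.sigma n) (i + 1) (m' + 1) * d.toB * (ascending (B.sigma n) (i + 1) (m + 1))⁻¹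
        ∈ (evalB (n := n) (i := i + 1)).range ∧
      ascending (B.sigma n) (i + 1) (m' + 1) * d.toB⁻¹ * (ascending (B.sigma n) (i + 1) (m + 1))⁻¹
        ∈ (evalB (n := n) (i := i + 1)).range := by
  -- If the coset is fixed, the statement for the inverse generator follows by inversion. Only σ_m
  -- and σ_{m+1} move the coset, and these need both computations.
  suffices H : (∃ m', i ≤ m' ∧ m' < n ∧
      ascending (B.sigma n) (i + 1) (m' + 1) * d.toB * (ascending (B.sigma n) (i + 1) (m + 1))⁻¹
        ∈ (evalB (n := n) (i := i + 1)).range ∧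
      ascending (B.sigma n) (i + 1) (m' + 1) * d.toB⁻¹ * (ascending (B.sigma n) (i + 1) (m + 1))⁻¹
        ∈ (evalB (n := n) (i := i + 1)).range) ∨
      ascending (B.sigma n) (i + 1) (m + 1) * d.toB * (ascending (B.sigma n) (i + 1) (m + 1))⁻¹
        ∈ (evalB (n := n) (i := i + 1)).range by
    rcases H with H | H
    · exact H
    · refine ⟨m, h, hm, H, ?_⟩
      convert inv_mem H using 1
      group
  rcases d with ⟨k, j, hkj⟩ | ⟨j, hj⟩
  · right
    exact strandBraids_le_range_evalB hkj.1 (by omega) (ascending_conj_strandBraids hkj.1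
      (by omega) (by omega) (by omega) (aElt_mem_strandBraids hkj.2.1 hkj.2.2.1))
  · simp only [DGen.toB]
    rcases lt_trichotomy j (m + 1) with hjm | rfl | hjm
    · rcases eq_or_lt_of_le (Nat.le_of_lt_succ hjm) with rfl | hjm'
      · obtain ⟨j, rfl⟩ : ∃ l, j = l + 1 := ⟨j - 1, by omega⟩
        left
        refine ⟨j, by omega, by omega, ?_, ?_⟩
        · convert one_mem (evalB (n := n) (i := i + 1)).range using 1
          rw [ascending_succ _ (by omega : i + 1 ≤ j + 1)]
          group
        · convert inv_mem (aElt_mem_range_evalB (n := n) (i := i + 1) (k := i + 1) (j := j + 1)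
            (by omega)) using 1
          rw [ascending_succ _ (by omega : i + 1 ≤ j + 1), aElt]
          group
      · right
        rw [B.ascending_mul_sigma (by omega) (by omega) (by omega) (by omega),
          mul_inv_cancel_right]
        exact sigma_mem_range_evalB (by omega)
    · left
      refine ⟨m + 1, by omega, by omega, ?_, ?_⟩
      · convert aElt_mem_range_evalB (n := n) (i := i + 1) (k := i + 1) (j := m + 1)
            (by omega) using 1
        rw [ascending_succ _ (by omega : i + 1 ≤ m + 1), aElt, pow_two]
        simp only [mul_assoc]
      · convert one_mem (evalB (n := n) (i := i + 1)).range using 1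
        rw [ascending_succ _ (by omega : i + 1 ≤ m + 1)]
        group
    · right
      have h2 : Commute (B.sigma n j) (ascending (B.sigma n) (i + 1) (m + 1)) :=
        Commute.ascending_right _ fun p h₁ h₂ => (B.sigma_comm (by omega)).symm
      rw [← h2.eq, mul_inv_cancel_right]
      exact sigma_mem_range_evalB (by omega)

/-- `D_{n,i}` is generated by the braids `a_{k,j}` and `σ_j`. -/
theorem D_le_range_evalB {n i : ℕ} (hi : i < n) : D n i ≤ (evalB (n := n) (i := i)).range := by
  induction i with
  | zero =>
    refine le_top.trans ?_
    rw [← B.closure_sigma, Subgroup.closure_le]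
    rintro _ ⟨j, h₁, h₂, rfl⟩
    exact sigma_mem_range_evalB (by omega)
  | succ i ih =>
    intro b hb
    have hb' : b ∈ Subgroup.closure (Set.range (DGen.toB (n := n) (i := i))) := by
      rw [← range_evalB]
      exact ih (by omega) (mem_D.2 fun x hx => mem_D.1 hb x (by omega))
    -- A Schreier argument: left multiplication by a generator permutes finitely many cosets of the
    -- subgroup generated at level i + 1, so `b` lies in one of them.
    have H : ∃ m, i ≤ m ∧ m < n ∧ ascending (B.sigma n) (i + 1) (m + 1) * b
        ∈ (evalB (n := n) (i := i + 1)).range := by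
      clear hb
      induction hb' using Subgroup.closure_induction_left with
      | one => exact ⟨i, le_rfl, by omega, by simp [ascending_self, one_mem]⟩
      | mul_left x hx y _ hy =>
        obtain ⟨d, rfl⟩ := hx
        obtain ⟨m, h₁, h₂, h₃⟩ := hy
        obtain ⟨m', h₁', h₂', h₃', -⟩ := exists_coset_step h₁ h₂ d
        refine ⟨m', h₁', h₂', ?_⟩
        convert mul_mem h₃' h₃ using 1
        group
      | inv_mul_cancel x hx y _ hy =>
        obtain ⟨d, rfl⟩ := hx
        obtain ⟨m, h₁, h₂, h₃⟩ := hy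
        obtain ⟨m', h₁', h₂', -, h₃'⟩ := exists_coset_step h₁ h₂ d
        refine ⟨m', h₁', h₂', ?_⟩
        convert mul_mem h₃' h₃ using 1
        group
    obtain ⟨m, h₁, h₂, h₃⟩ := H
    -- `b` fixes the strand `i`, while the coset representative carries it to `m`. So `m = i` and
    -- the representative is trivial.
    have h4 := mem_D.1 (mul_mem hb (inv_mem (range_evalB_le _ _ h₃))) i (by omega)
    rw [mul_inv_rev, mul_inv_cancel_left, natPerm_ascending_inv h₁ h₂] at h4
    subst h4
    simpa [ascending_self] using h₃

/-! ### Group identities behind the exchange of two pairs of strands -/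

section Groups

variable {G : Type*} [Group G] {g s s' t : G}

/-- Both sides of the four-letter relation end in g² once g² is moved past t; cancelling it leaves a
commutation. This turns the relation with two letters τ_1 into one between conjugates. -/
theorem commute_conj_iff (h : Commute (g ^ 2) t) :
    Commute t (g * t * g⁻¹) ↔ g * t * g * t = t * g * t * g := by
  have e1 : g * t * g * t = g * t * g⁻¹ * t * g ^ 2 := by
    rw [mul_assoc _ t (g ^ 2), ← h.eq]; group
  have e2 : t * g * t * g = t * (g * t * g⁻¹) * g ^ 2 := by group
  rw [e1, e2, mul_left_inj, commute_iff_eq, eq_comm]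

/-- In the applications s and s' are σ_1 and σ_3, or their inverses, which g exchanges. The
conjugate of s t is s' (g t g⁻¹), and each factor of s t commutes with each factor of it. -/
theorem commute_mul_conj (hst' : Commute s' t) (hss : Commute s s')
    (h : g * s = s' * g) (h' : g * s' = s * g) (ht : Commute t (g * t * g⁻¹)) :
    Commute (s * t) (g * (s * t) * g⁻¹) := by
  have e : g * (s * t) * g⁻¹ = s' * (g * t * g⁻¹) := by
    rw [← mul_assoc, h]; simp only [mul_assoc]
  have h1 : Commute s (g * t * g⁻¹) := by
    have : s = g * s' * g⁻¹ := by rw [h', mul_inv_cancel_right]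
    rw [this]
    exact (Commute.conj_iff g).2 hst'
  rw [e]
  exact (hss.mul_right h1).mul_left (hst'.symm.mul_right ht)

theorem four_strand_mul_left {a b c : G} (hbc : b * c * b = c * b * c)
    (hab : a * b * a = b * a * b) :
    b * c * a * b * a = c * (b * c * a * b) := by
  calc _ = b * c * (a * b * a) := by simp only [mul_assoc]
    _ = b * c * b * a * b := by rw [hab]; simp only [mul_assoc]
    _ = _ := by rw [hbc]; simp only [mul_assoc]

theorem four_strand_mul_right {a b c : G} (hab : a * b * a = b * a * b)
    (hbc : b * c * b = c * b * c) (hac : Commute a c) :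
    b * c * a * b * c = a * (b * c * a * b) := by
  have e : b * c * a * b = b * a * c * b := by rw [mul_assoc b, ← hac.eq, ← mul_assoc]
  rw [e]
  exact four_strand_mul_left hab.symm hbc.symm

/-- The square becomes a word in σ_3 and σ_2 σ_1² σ_2, both of which commute with τ_1. The trick is
to multiply by c² on the right and slide it through one copy of the exchange, where it becomes a².
-/
theorem four_strand_sq {a b c : G} (hab : a * b * a = b * a * b) (hbc : b * c * b = c * b * c)
    (hac : Commute a c) :
    (b * c * a * b) ^ 2 = c * (b * a ^ 2 * b) * c * (b * a ^ 2 * b) * (c ^ 2)⁻¹ := by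
  have h := four_strand_mul_right hab hbc hac
  have e : b * c * a * b = b * a * c * b := by rw [mul_assoc b, ← hac.eq, ← mul_assoc]
  have h' : b * a * a * b * a * a = a * b * a * a * b * a := by
    calc _ = b * a * (a * b * a) * a := by simp only [mul_assoc]
      _ = (b * a * b) * a * b * a := by rw [hab]; simp only [mul_assoc]
      _ = a * b * a * (a * b * a) := by rw [← hab]; simp only [mul_assoc]
      _ = _ := by simp only [mul_assoc]
  have hca : a * a * c = c * a * a := by rw [mul_assoc, hac.eq, ← mul_assoc, hac.eq]
  have h2 : b * c * a * b * c * c = a * (a * (b * a * c * b)) := by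
    rw [h, mul_assoc a, h, e]
  rw [eq_mul_inv_iff_mul_eq]
  calc _ = b * c * a * b * (b * c * a * b * c * c) := by simp only [pow_two, mul_assoc]
    _ = b * c * a * b * (a * (a * (b * a * c * b))) := by rw [h2]
    _ = b * c * (a * b * a * a * b * a) * c * b := by simp only [mul_assoc]
    _ = b * c * b * a * a * b * (a * a * c) * b := by rw [← h']; simp only [mul_assoc]
    _ = c * b * (c * a * a) * b * (c * a * a) * b := by rw [hbc, hca]; simp only [mul_assoc]
    _ = c * b * (a * a * c) * b * (c * a * a) * b := by rw [hca]
    _ = c * b * a * a * (c * b * c) * a * a * b := by simp only [mul_assoc]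
    _ = _ := by rw [← hbc]; simp only [pow_two, mul_assoc]

end Groups

/-! ### The singular braid group -/

theorem SG.sigma_of_not {n j : ℕ} (h : ¬ (1 ≤ j ∧ j < n)) : SG.sigma n j = 1 := by
  simp [SG.sigma, SingGen.word, h]

/-- The natural homomorphism `B_n → SG_n`. -/
def B.toSG (n : ℕ) : B n →* SG n :=
  PresentedGroup.toGroup (f := fun x => match x with | .sigma j _ => SG.sigma n j) (by
    have hw : ∀ j, FreeGroup.lift (fun x : BraidGen n => match x with
        | .sigma j _ => SG.sigma n j) (BraidGen.word n j) = SG.sigma n j := by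
      intro j
      by_cases h : 1 ≤ j ∧ j < n
      · rw [BraidGen.word, dif_pos h, FreeGroup.lift_apply_of]
      · rw [BraidGen.word, dif_neg h, map_one, SG.sigma_of_not h]
    rintro r (⟨j, h₁, h₂⟩ | ⟨j, k, h₁, h₂, h₃⟩)
    · have := PresentedGroup.one_of_mem (rels := {r | SingRel n r}) (SingRel.braid j h₁ h₂)
      rw [rel, map_mul, map_inv, mul_inv_eq_one, map_mul, map_mul, map_mul, map_mul] at this
      rw [rel, map_mul, map_inv, mul_inv_eq_one, map_mul, map_mul, map_mul, map_mul, hw, hw]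
      exact this
    · have := PresentedGroup.one_of_mem (rels := {r | SingRel n r}) (SingRel.comm j k h₁ h₂ h₃)
      rw [rel, map_mul, map_inv, mul_inv_eq_one, map_mul, map_mul] at this
      rw [rel, map_mul, map_inv, mul_inv_eq_one, map_mul, map_mul, hw, hw]
      exact this)

theorem B.toSG_sigma (n j : ℕ) : B.toSG n (B.sigma n j) = SG.sigma n j := by
  by_cases h : 1 ≤ j ∧ j < n
  · rw [B.sigma, BraidGen.word, dif_pos h]
    exact PresentedGroup.toGroup.of _
  · rw [B.sigma_of_not h, map_one, SG.sigma_of_not h]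

theorem SG.perm_sigma {n j : ℕ} (h : 1 ≤ j ∧ j < n) :
    SG.perm n (SG.sigma n j) = transposition n j h := by
  rw [SG.sigma, SingGen.word, dif_pos h]
  exact PresentedGroup.toGroup.of _

theorem SG.perm_toSG {n : ℕ} (b : B n) : SG.perm n (B.toSG n b) = B.perm n b := by
  have : (SG.perm n).comp (B.toSG n) = B.perm n := by
    apply MonoidHom.eq_of_eqOn_dense (B.closure_sigma n)
    rintro _ ⟨j, h₁, h₂, rfl⟩
    rw [MonoidHom.comp_apply, B.toSG_sigma, SG.perm_sigma ⟨h₁, h₂⟩, B.perm_sigma ⟨h₁, h₂⟩]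
  exact DFunLike.congr_fun this b

theorem SG.perm_tau_one {n : ℕ} (h : 1 < n) :
    SG.perm n (SG.tau n 1) = transposition n 1 ⟨le_rfl, h⟩ := by
  rw [SG.tau, SingGen.tauWord, dif_pos h]
  exact PresentedGroup.toGroup.of _

theorem SG.sigma_tau_one {n j : ℕ} (h : j ≠ 2) : Commute (SG.sigma n j) (SG.tau n 1) := by
  by_cases hj : 1 ≤ j ∧ j < n
  · have := PresentedGroup.one_of_mem (rels := {r | SingRel n r})
      (SingRel.tau_sigma j hj.1 hj.2 h)
    rw [rel, map_mul, map_inv, mul_inv_eq_one, map_mul, map_mul] at this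
    exact this
  · rw [SG.sigma_of_not hj]; exact Commute.one_left _

/-- The braid `σ_2 σ_1² σ_2`. -/
def B.encircle (n : ℕ) : B n := B.sigma n 2 * B.sigma n 1 ^ 2 * B.sigma n 2

/-- The braid `σ_2 σ_3 σ_1 σ_2`, which exchanges two pairs of strands. -/
def B.exchange (n : ℕ) : B n := B.sigma n 2 * B.sigma n 3 * B.sigma n 1 * B.sigma n 2

theorem SG.encircle_tau {n : ℕ} (h : 2 < n) : Commute (B.toSG n (B.encircle n)) (SG.tau n 1) := by
  have := PresentedGroup.one_of_mem (rels := {r | SingRel n r}) (SingRel.tau_pure h)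
  rw [rel, map_mul, map_inv, mul_inv_eq_one] at this
  simp only [map_mul, map_pow] at this
  rw [B.encircle, commute_iff_eq]
  simp only [map_mul, map_pow, B.toSG_sigma]
  simp only [mul_assoc] at this ⊢
  exact this

theorem SG.exchange_tau {n : ℕ} (h : 3 < n) :
    B.toSG n (B.exchange n) * SG.tau n 1 * B.toSG n (B.exchange n) * SG.tau n 1
      = SG.tau n 1 * B.toSG n (B.exchange n) * SG.tau n 1 * B.toSG n (B.exchange n) := by
  have := PresentedGroup.one_of_mem (rels := {r | SingRel n r}) (SingRel.tau_tau h)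
  rw [rel, map_mul, map_inv, mul_inv_eq_one] at this
  simp only [map_mul] at this
  simp only [B.exchange, map_mul, B.toSG_sigma]
  simp only [mul_assoc] at this ⊢
  exact this

/-! ### The exchange braid and the stabilizer of σ_1 τ_1 -/

section Exchange

variable {n : ℕ}

theorem B.exchange_mul_sigma_one (h : 3 < n) :
    B.exchange n * B.sigma n 1 = B.sigma n 3 * B.exchange n :=
  four_strand_mul_left (B.sigma_braid (by omega) h) (B.sigma_braid (by omega) (by omega))

theorem B.exchange_mul_sigma_three (h : 3 < n) :
    B.exchange n * B.sigma n 3 = B.sigma n 1 * B.exchange n :=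
  four_strand_mul_right (B.sigma_braid (by omega) (by omega)) (B.sigma_braid (by omega) h)
    (B.sigma_comm (by omega))

theorem B.exchange_sq (h : 3 < n) :
    B.exchange n ^ 2 = B.sigma n 3 * B.encircle n * B.sigma n 3 * B.encircle n
      * (B.sigma n 3 ^ 2)⁻¹ :=
  four_strand_sq (B.sigma_braid (by omega) (by omega)) (B.sigma_braid (by omega) h)
    (B.sigma_comm (by omega))

/-- The braids that commute with `σ_1` and with `τ_1`. -/
def tauStab (n : ℕ) : Subgroup (B n) :=
  Subgroup.centralizer {B.sigma n 1} ⊓ (Subgroup.centralizer {SG.tau n 1}).comap (B.toSG n)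

theorem mem_tauStab {c : B n} :
    c ∈ tauStab n ↔ Commute c (B.sigma n 1) ∧ Commute (B.toSG n c) (SG.tau n 1) := by
  simp [tauStab, Subgroup.mem_centralizer_singleton_iff, commute_iff_eq, eq_comm]

theorem sigma_mem_tauStab {j : ℕ} (h : j ≠ 2) : B.sigma n j ∈ tauStab n := by
  rw [mem_tauStab, B.toSG_sigma]
  refine ⟨?_, SG.sigma_tau_one h⟩
  rcases j with _ | _ | _ | j
  · rw [B.sigma_of_not (by omega)]; exact Commute.one_left _
  · exact Commute.refl _
  · exact absurd rfl h
  · exact (B.sigma_comm (by omega)).symm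

theorem encircle_mem_tauStab (h : 2 < n) : B.encircle n ∈ tauStab n := by
  refine mem_tauStab.2 ⟨?_, SG.encircle_tau h⟩
  have h' := B.sigma_braid (n := n) (j := 1) le_rfl h
  rw [commute_iff_eq, B.encircle]
  calc _ = B.sigma n 2 * B.sigma n 1 * (B.sigma n 1 * B.sigma n 2 * B.sigma n 1) := by
        simp only [pow_two, mul_assoc]
    _ = (B.sigma n 2 * B.sigma n 1 * B.sigma n 2) * B.sigma n 1 * B.sigma n 2 := by
        rw [h']; simp only [mul_assoc]
    _ = _ := by rw [← h']; simp only [pow_two, mul_assoc]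

theorem exchange_sq_mem_tauStab (h : 3 < n) : B.exchange n ^ 2 ∈ tauStab n := by
  have h3 := sigma_mem_tauStab (n := n) (j := 3) (by omega)
  have hT := encircle_mem_tauStab (n := n) (by omega)
  rw [B.exchange_sq h]
  exact mul_mem (mul_mem (mul_mem (mul_mem h3 hT) h3) hT) (inv_mem (pow_mem h3 2))

theorem tailBraids_two_le_tauStab (n : ℕ) : tailBraids n 2 ≤ tauStab n :=
  tailBraids_le fun _ _ _ => sigma_mem_tauStab (by omega)

/-- The element `σ_1 τ_1`. -/
def SG.zeta (n : ℕ) : SG n := SG.sigma n 1 * SG.tau n 1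

theorem toSG_commute_zeta {c : B n} (hc : c ∈ tauStab n) : Commute (B.toSG n c) (SG.zeta n) := by
  rw [mem_tauStab] at hc
  rw [SG.zeta, ← B.toSG_sigma]
  exact (hc.1.map (B.toSG n)).mul_right hc.2

/-- The square of the exchange commutes with τ_1, so `commute_conj_iff` turns the defining relation
into a commutation of τ_1 with its conjugate; `commute_mul_conj` then adds the factor σ_1. -/
theorem SG.zeta_commute_exchange (h : 3 < n) :
    Commute (SG.zeta n) (B.toSG n (B.exchange n) * SG.zeta n * (B.toSG n (B.exchange n))⁻¹) := by
  apply commute_mul_conj (s' := SG.sigma n 3) (SG.sigma_tau_one (by omega))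
  · rw [← B.toSG_sigma, ← B.toSG_sigma]
    exact (B.sigma_comm (by omega)).map _
  · rw [← B.toSG_sigma, ← map_mul, B.exchange_mul_sigma_one h, map_mul, B.toSG_sigma]
  · rw [← B.toSG_sigma, ← map_mul, B.exchange_mul_sigma_three h, map_mul, B.toSG_sigma]
  · rw [commute_conj_iff]
    · exact SG.exchange_tau h
    · rw [← map_pow]
      exact (mem_tauStab.1 (exchange_sq_mem_tauStab h)).2

theorem SG.perm_zeta (h : 1 < n) : SG.perm n (SG.zeta n) = 1 := by
  rw [SG.zeta, map_mul, SG.perm_sigma ⟨le_rfl, h⟩, SG.perm_tau_one h, transposition_sq]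

end Exchange

/-! ### Shifting the strands -/

/-- The braid `σ_1 σ_2 ⋯ σ_{n-1}`. -/
def B.shift (n : ℕ) : B n := ascending (B.sigma n) 1 n

theorem B.shift_mul_sigma {n j : ℕ} (h : 1 ≤ j) (h' : j + 1 < n) :
    B.shift n * B.sigma n j = B.sigma n (j + 1) * B.shift n :=
  B.ascending_mul_sigma le_rfl h h' le_rfl

theorem B.shift_pow_mul_sigma {n j k : ℕ} (h : 1 ≤ j) (h' : j + k < n) :
    B.shift n ^ k * B.sigma n j = B.sigma n (j + k) * B.shift n ^ k := by
  induction k with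
  | zero => simp
  | succ k ih =>
    rw [pow_succ', mul_assoc, ih (by omega), ← mul_assoc, B.shift_mul_sigma (by omega) (by omega),
      mul_assoc, add_assoc]

theorem B.natPerm_ascending_one {n k : ℕ} (hk : k < n) (x : ℕ) :
    B.natPerm n (ascending (B.sigma n) 1 (k + 1)) x
      = if x < k then x + 1 else if x = k then 0 else x := by
  induction k generalizing x with
  | zero => by_cases hx : x = 0 <;> simp [ascending_self, hx]
  | succ k ih =>
    rw [ascending_succ _ (by omega), map_mul, Equiv.Perm.mul_apply, B.natPerm_sigma (by omega),
      ih (by omega), Equiv.swap_apply_def]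
    grind

theorem B.natPerm_shift {n x : ℕ} (h : x + 1 < n) : B.natPerm n (B.shift n) x = x + 1 := by
  obtain ⟨k, rfl⟩ : ∃ k, n = k + 1 := ⟨n - 1, by omega⟩
  rw [B.shift, B.natPerm_ascending_one (by omega), if_pos (by omega)]

theorem B.natPerm_shift_pow {n x k : ℕ} (h : x + k < n) :
    B.natPerm n (B.shift n ^ k) x = x + k := by
  induction k with
  | zero => simp
  | succ k ih =>
    rw [pow_succ', map_mul, Equiv.Perm.mul_apply, ih (by omega), B.natPerm_shift (by omega),
      add_assoc]

theorem B.shift_eq {n : ℕ} (h : 2 < n) :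
    B.shift n = B.sigma n 1 * B.sigma n 2 * ascending (B.sigma n) 3 n := by
  rw [B.shift, ← ascending_mul _ (by omega : 1 ≤ 3) (by omega), ascending_succ _ (by omega),
    ascending_succ _ (by omega), ascending_self, one_mul]

theorem ascending_three_mem_tauStab (n : ℕ) :
    ascending (B.sigma n) 3 n ∈ tauStab n := by
  apply Subgroup.list_prod_mem
  intro x hx
  simp only [List.mem_map, List.mem_range'_1] at hx
  obtain ⟨m, hm, rfl⟩ := hx
  exact sigma_mem_tauStab (by omega)

/-- For j = 1 the factors of the shift after σ_1 σ_2 commute with τ_1, and what remains is the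
definition of τ_2. Afterwards the shift carries the recursion for τ_j to the next one. -/
theorem SG.shift_mul_tau {n j : ℕ} (h : 1 ≤ j) (h' : j + 1 < n) :
    B.toSG n (B.shift n) * SG.tau n j = SG.tau n (j + 1) * B.toSG n (B.shift n) := by
  induction j, h using Nat.le_induction with
  | base =>
    have := (mem_tauStab.1 (ascending_three_mem_tauStab n)).2.eq
    have e : SG.tau n (1 + 1) = SG.sigma n 1 * SG.sigma n 2 * SG.tau n 1
      * (SG.sigma n 2)⁻¹ * (SG.sigma n 1)⁻¹ := rfl
    rw [B.shift_eq (by omega), map_mul, map_mul, mul_assoc, this, e]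
    simp only [B.toSG_sigma]
    group
  | succ j hj ih =>
    have h1 := congrArg (B.toSG n) (B.shift_mul_sigma (n := n) hj (by omega))
    have h2 := congrArg (B.toSG n) (B.shift_mul_sigma (n := n) (j := j + 1) (by omega) (by omega))
    simp only [map_mul, B.toSG_sigma] at h1 h2
    obtain ⟨j, rfl⟩ : ∃ l, j = l + 1 := ⟨j - 1, by omega⟩
    have h3 := ih (by omega)
    rw [← mul_inv_eq_iff_eq_mul] at h1 h2 h3 ⊢
    have e : SG.tau n (j + 1 + 1 + 1) = SG.sigma n (j + 1 + 1) * SG.sigma n (j + 1 + 1 + 1)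
      * SG.tau n (j + 1 + 1) * (SG.sigma n (j + 1 + 1 + 1))⁻¹ * (SG.sigma n (j + 1 + 1))⁻¹ := rfl
    have e' : SG.tau n (j + 1 + 1) = SG.sigma n (j + 1) * SG.sigma n (j + 1 + 1)
      * SG.tau n (j + 1) * (SG.sigma n (j + 1 + 1))⁻¹ * (SG.sigma n (j + 1))⁻¹ := rfl
    rw [e]
    generalize B.toSG n (B.shift n) = x at *
    symm
    calc _ = (x * SG.sigma n (j + 1) * x⁻¹) * (x * SG.sigma n (j + 1 + 1) * x⁻¹)
          * (x * SG.tau n (j + 1) * x⁻¹) * (x * SG.sigma n (j + 1 + 1) * x⁻¹)⁻¹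
          * (x * SG.sigma n (j + 1) * x⁻¹)⁻¹ := by rw [h1, h2, h3]
      _ = x * (SG.sigma n (j + 1) * SG.sigma n (j + 1 + 1) * SG.tau n (j + 1)
          * (SG.sigma n (j + 1 + 1))⁻¹ * (SG.sigma n (j + 1))⁻¹) * x⁻¹ := by group
      _ = _ := by rw [e']

theorem SG.tau_succ {n k : ℕ} (h : k + 1 < n) :
    SG.tau n (k + 1) = B.toSG n (B.shift n ^ k) * SG.tau n 1 * (B.toSG n (B.shift n ^ k))⁻¹ := by
  rw [eq_mul_inv_iff_mul_eq]
  induction k with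
  | zero => simp
  | succ k ih =>
    rw [pow_succ', map_mul, ← mul_assoc, ← SG.shift_mul_tau (by omega) (by omega), mul_assoc,
      ih (by omega), mul_assoc]

theorem B.sigma_succ {n k : ℕ} (h : k + 1 < n) :
    B.sigma n (k + 1) = B.shift n ^ k * B.sigma n 1 * (B.shift n ^ k)⁻¹ := by
  rw [B.shift_pow_mul_sigma le_rfl (by omega), mul_inv_cancel_right, add_comm]

theorem SG.sigma_mul_tau {n k : ℕ} (h : k + 1 < n) :
    SG.sigma n (k + 1) * SG.tau n (k + 1)
      = B.toSG n (B.shift n ^ k) * SG.zeta n * (B.toSG n (B.shift n ^ k))⁻¹ := by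
  rw [SG.tau_succ h, ← B.toSG_sigma, B.sigma_succ h, SG.zeta, ← B.toSG_sigma]
  simp only [map_mul, map_inv]
  group

/-- The exchange conjugates σ_3 to σ_1 and τ_1 to τ_3, so the case k = 3 is the relation between σ_3
and τ_1. Each later τ_k is a conjugate by generators that commute with σ_1. -/
theorem SG.sigma_one_tau {n k : ℕ} (h : 3 ≤ k) (h' : k < n) :
    Commute (SG.sigma n 1) (SG.tau n k) := by
  induction k, h using Nat.le_induction with
  | base =>
    have e : SG.tau n 3
        = B.toSG n (B.exchange n) * SG.tau n 1 * (B.toSG n (B.exchange n))⁻¹ := by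
      have : SG.tau n 3 = SG.sigma n 2 * SG.sigma n 3 * (SG.sigma n 1 * SG.sigma n 2
        * SG.tau n 1 * (SG.sigma n 2)⁻¹ * (SG.sigma n 1)⁻¹) * (SG.sigma n 3)⁻¹
        * (SG.sigma n 2)⁻¹ := rfl
      rw [this, B.exchange]
      simp only [map_mul, B.toSG_sigma]
      group
    have e' : SG.sigma n 1 = B.toSG n (B.exchange n) * SG.sigma n 3
        * (B.toSG n (B.exchange n))⁻¹ := by
      rw [← B.toSG_sigma, ← B.toSG_sigma, ← map_mul, B.exchange_mul_sigma_three h', map_mul,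
        mul_inv_cancel_right]
    rw [e, e']
    exact (Commute.conj_iff _).2 (SG.sigma_tau_one (by omega))
  | succ k hk ih =>
    obtain ⟨k, rfl⟩ : ∃ l, k = l + 1 := ⟨k - 1, by omega⟩
    have h1 : Commute (SG.sigma n 1) (SG.sigma n (k + 1)) := by
      rw [← B.toSG_sigma, ← B.toSG_sigma]
      exact (B.sigma_comm (by omega)).map _
    have h2 : Commute (SG.sigma n 1) (SG.sigma n (k + 2)) := by
      rw [← B.toSG_sigma, ← B.toSG_sigma]
      exact (B.sigma_comm (by omega)).map _
    rw [SG.tau]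
    exact ((((h1.mul_right h2).mul_right (ih (by omega))).mul_right h2.inv_right).mul_right
      h1.inv_right)

/-- For j > k the shift takes σ_j back to σ_{j-k}, which is not σ_2. For j < k, undoing only part of
the shift reduces the claim to σ_1 against σ_{m+1} and τ_{m+1} with m ≥ 2. -/
theorem sigma_conj_shift_pow_mem_tauStab {n j k : ℕ} (hk : k + 1 < n) (h : j ≠ k)
    (h' : j ≠ k + 2) : (B.shift n ^ k)⁻¹ * B.sigma n j * B.shift n ^ k ∈ tauStab n := by
  by_cases hj : 1 ≤ j ∧ j < n
  swap
  · rw [B.sigma_of_not hj]; simp [one_mem]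
  rcases lt_or_ge k j with hkj | hkj
  · obtain ⟨l, rfl⟩ := Nat.exists_eq_add_of_lt hkj
    have := B.shift_pow_mul_sigma (n := n) (j := l + 1) (k := k) (by omega) (by omega)
    rw [show k + l + 1 = l + 1 + k by omega, mul_assoc, ← this, inv_mul_cancel_left]
    exact sigma_mem_tauStab (by omega)
  · obtain ⟨l, rfl⟩ : ∃ l, j = l + 1 := ⟨j - 1, by omega⟩
    obtain ⟨m, rfl⟩ := Nat.exists_eq_add_of_le (by omega : l ≤ k)
    have e : (B.shift n ^ (l + m))⁻¹ * B.sigma n (l + 1) * B.shift n ^ (l + m)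
        = (B.shift n ^ m)⁻¹ * B.sigma n 1 * B.shift n ^ m := by
      rw [B.sigma_succ hj.2, pow_add]; group
    rw [e, mem_tauStab]
    constructor
    · rw [← Commute.conj_iff (B.shift n ^ m), ← B.sigma_succ (by omega)]
      convert (B.sigma_comm (n := n) (j := 1) (k := m + 1) (by omega)) using 1
      group
    · rw [← Commute.conj_iff (B.toSG n (B.shift n ^ m)), ← SG.tau_succ (by omega)]
      convert SG.sigma_one_tau (n := n) (k := m + 1) (by omega) (by omega) using 1
      rw [← B.toSG_sigma]
      simp only [map_mul, map_inv]
      group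

/-! ### Conjugates of `σ_1 τ_1` -/

/-- The conjugates of `σ_1 τ_1` by braids, as cosets of `tauStab n`. -/
abbrev Vertex (n : ℕ) : Type := B n ⧸ tauStab n

/-- The coset of a braid. -/
def vtx {n : ℕ} (b : B n) : Vertex n := (b : B n ⧸ tauStab n)

section Vertices

variable {n : ℕ}

theorem smul_vtx (b b' : B n) : b • vtx b' = vtx (b * b') := rfl

theorem vtx_surjective (v : Vertex n) : ∃ b, vtx b = v := QuotientGroup.mk_surjective v

theorem vtx_eq {b b' : B n} : vtx b = vtx b' ↔ b⁻¹ * b' ∈ tauStab n := QuotientGroup.eq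

theorem vtx_mul_of_mem (b : B n) {c : B n} (hc : c ∈ tauStab n) : vtx (b * c) = vtx b := by
  rw [eq_comm, vtx_eq, inv_mul_cancel_left]
  exact hc

/-- The conjugate of `σ_1 τ_1` by a braid. -/
def conjZeta (b : B n) : SG n := B.toSG n b * SG.zeta n * (B.toSG n b)⁻¹

theorem conjZeta_congr {b b' : B n} (h : vtx b = vtx b') : conjZeta b = conjZeta b' := by
  have := (toSG_commute_zeta (vtx_eq.1 h)).eq
  rw [map_mul, map_inv] at this
  rw [conjZeta, conjZeta, mul_inv_eq_iff_eq_mul]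
  calc _ = B.toSG n b * (SG.zeta n * ((B.toSG n b)⁻¹ * B.toSG n b')) * (B.toSG n b')⁻¹
        * B.toSG n b := by group
    _ = _ := by rw [← this]; group

theorem conjZeta_mul (b b' : B n) :
    conjZeta (b * b') = B.toSG n b * conjZeta b' * (B.toSG n b)⁻¹ := by
  rw [conjZeta, conjZeta, map_mul]; group

/-- The pairs of conjugates that commute by the relation between `τ_1` and `τ_3`. -/
def Adj (v v' : Vertex n) : Prop :=
  3 < n ∧ ∃ b, vtx b = v ∧ vtx (b * B.exchange n) = v'

theorem Adj.smul {v v' : Vertex n} (h : Adj v v') (b : B n) : Adj (b • v) (b • v') := by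
  obtain ⟨hn, c, rfl, rfl⟩ := h
  exact ⟨hn, b * c, rfl, by rw [smul_vtx, mul_assoc]⟩

theorem Adj.commute {b b' : B n} (h : Adj (vtx b) (vtx b')) :
    Commute (conjZeta b) (conjZeta b') := by
  obtain ⟨hn, c, h1, h2⟩ := h
  rw [← conjZeta_congr h1, ← conjZeta_congr h2, conjZeta_mul, conjZeta, Commute.conj_iff]
  exact SG.zeta_commute_exchange hn

/-! ### The strands of a vertex -/

/-- Commuting with σ_1 forces the permutation to commute with the transposition of the first two
strands, hence to preserve this pair. Nothing about τ_1 is needed. -/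
theorem natPerm_tauStab (hn : 1 < n) {c : B n} (hc : c ∈ tauStab n) :
    (B.natPerm n c 0 = 0 ∧ B.natPerm n c 1 = 1) ∨
      (B.natPerm n c 0 = 1 ∧ B.natPerm n c 1 = 0) := by
  have h := congrArg (B.natPerm n) (mem_tauStab.1 hc).1.eq
  rw [map_mul, map_mul, B.natPerm_sigma ⟨le_rfl, hn⟩] at h
  have h0 := DFunLike.congr_fun h 0
  have h1 := (B.natPerm n c).injective.ne (show 0 ≠ 1 by omega)
  simp only [Equiv.Perm.mul_apply, Equiv.swap_apply_def] at h0
  simp only [Nat.sub_self, if_true] at h0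
  split_ifs at h0 <;> omega

theorem natPerm_sigma_of_lt {j x : ℕ} (h : x + 1 < j) : B.natPerm n (B.sigma n j) x = x := by
  by_cases hj : j < n
  · rw [B.natPerm_sigma (by omega), Equiv.swap_apply_of_ne_of_ne] <;> omega
  · rw [B.sigma_of_not (by omega)]; simp

theorem natPerm_exchange_zero (h : 3 < n) : B.natPerm n (B.exchange n) 0 = 2 := by
  simp [B.exchange, B.natPerm_sigma (show 1 ≤ 1 ∧ 1 < n by omega),
    B.natPerm_sigma (show 1 ≤ 2 ∧ 2 < n by omega), B.natPerm_sigma (show 1 ≤ 3 ∧ 3 < n by omega),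
    Equiv.swap_apply_def]

theorem natPerm_exchange_one (h : 3 < n) : B.natPerm n (B.exchange n) 1 = 3 := by
  simp [B.exchange, B.natPerm_sigma (show 1 ≤ 1 ∧ 1 < n by omega),
    B.natPerm_sigma (show 1 ≤ 2 ∧ 2 < n by omega), B.natPerm_sigma (show 1 ≤ 3 ∧ 3 < n by omega),
    Equiv.swap_apply_def]

/-- A representative whose permutation is increasing on the first two strands. -/
theorem exists_vtx_eq (hn : 1 < n) (b : B n) :
    ∃ b', vtx b' = vtx b ∧ B.natPerm n b' 0 < B.natPerm n b' 1 := by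
  have h1 := (B.natPerm n b).injective.ne (show 0 ≠ 1 by omega)
  rcases h1.lt_or_gt with h | h
  · exact ⟨b, rfl, h⟩
  · refine ⟨b * B.sigma n 1, vtx_mul_of_mem b (sigma_mem_tauStab (by omega)), ?_⟩
    simpa [B.natPerm_sigma (show 1 ≤ 1 ∧ 1 < n by omega)] using h

/-- The unordered pair of strands of a vertex is well defined. -/
theorem natPerm_of_vtx_eq (hn : 1 < n) {b b' : B n} (h : vtx b = vtx b') :
    (B.natPerm n b' 0 = B.natPerm n b 0 ∧ B.natPerm n b' 1 = B.natPerm n b 1) ∨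
      (B.natPerm n b' 0 = B.natPerm n b 1 ∧ B.natPerm n b' 1 = B.natPerm n b 0) := by
  obtain ⟨c, hc, rfl⟩ : ∃ c ∈ tauStab n, b' = b * c := ⟨_, vtx_eq.1 h, by group⟩
  rcases natPerm_tauStab hn hc with ⟨h0, h1⟩ | ⟨h0, h1⟩ <;> simp [h0, h1]

/-- The exchange interchanges σ_1 and σ_3 under conjugation, so right multiplication of `b` by
either of them changes neither vertex. This allows both pairs of strands to be sorted. -/
theorem Adj.exists_vtx {v v' : Vertex n} (h : Adj v v') : ∃ b, vtx b = v ∧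
    vtx (b * B.exchange n) = v' ∧ B.natPerm n b 0 < B.natPerm n b 1 ∧
    B.natPerm n b 2 < B.natPerm n b 3 := by
  obtain ⟨hn, b, rfl, rfl⟩ := h
  have h1 : B.natPerm n (B.sigma n 1) = Equiv.swap 0 1 := B.natPerm_sigma (by omega)
  have h3 : B.natPerm n (B.sigma n 3) = Equiv.swap 2 3 := B.natPerm_sigma (by omega)
  have e1 := B.exchange_mul_sigma_one hn
  have e3 := B.exchange_mul_sigma_three hn
  have key : ∀ b : B n, ∃ b', vtx b' = vtx b ∧
      vtx (b' * B.exchange n) = vtx (b * B.exchange n) ∧ B.natPerm n b' 0 < B.natPerm n b' 1 ∧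
      B.natPerm n b' 2 = B.natPerm n b 2 ∧ B.natPerm n b' 3 = B.natPerm n b 3 := by
    intro b
    rcases ((B.natPerm n b).injective.ne (show 0 ≠ 1 by omega)).lt_or_gt with h | h
    · exact ⟨b, rfl, rfl, h, rfl, rfl⟩
    · refine ⟨b * B.sigma n 1, vtx_mul_of_mem b (sigma_mem_tauStab (by omega)), ?_, ?_, ?_, ?_⟩
      · rw [mul_assoc, ← e3, ← mul_assoc, vtx_mul_of_mem _ (sigma_mem_tauStab (by omega))]
      all_goals simp [h1, Equiv.swap_apply_def, h]
  obtain ⟨b', h4, h5, h6, h7, h8⟩ := key b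
  rcases ((B.natPerm n b').injective.ne (show 2 ≠ 3 by omega)).lt_or_gt with h | h
  · exact ⟨b', h4, h5, h6, h⟩
  · refine ⟨b' * B.sigma n 3, ?_, ?_, ?_, ?_⟩
    · rw [vtx_mul_of_mem _ (sigma_mem_tauStab (by omega)), h4]
    · rw [mul_assoc, ← e1, ← mul_assoc, vtx_mul_of_mem _ (sigma_mem_tauStab (by omega)), h5]
    all_goals simp [h3, Equiv.swap_apply_def, h, h6]

/-! ### Orbits of `D_{n,i}` -/

/-- Braids generated by σ_j with j > 2 lie in `tauStab`, so the right-hand factor in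
`exists_eq_mul_mul` does not affect the vertex. -/
theorem vtx_orbit {i : ℕ} {b b' d₀ : B n} (hd : d₀ ∈ D n i)
    (h : ∀ x < 2, B.natPerm n b x = B.natPerm n (d₀ * b') x) :
    ∃ d ∈ D n i, vtx b = vtx (d * b') := by
  obtain ⟨d, hd, c, hc, rfl⟩ := exists_eq_mul_mul hd h
  exact ⟨d, hd, vtx_mul_of_mem _ (tailBraids_two_le_tauStab n hc)⟩

/-- Braids generated by σ_j with j > 4 also commute with the exchange, so they fix both ends of an
adjacent pair. Four strands thus determine the orbit of the pair. -/
theorem adj_orbit {i : ℕ} {b b' d₀ : B n} (hd : d₀ ∈ D n i)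
    (h : ∀ x < 4, B.natPerm n b x = B.natPerm n (d₀ * b') x) :
    ∃ d ∈ D n i, vtx b = d • vtx b' ∧ vtx (b * B.exchange n) = d • vtx (b' * B.exchange n) := by
  obtain ⟨d, hd, c, hc, rfl⟩ := exists_eq_mul_mul hd h
  refine ⟨d, hd, vtx_mul_of_mem _ (tailBraids_two_le_tauStab n (tailBraids_anti (by omega) hc)),
    ?_⟩
  have h1 : tailBraids n 4 ≤ Subgroup.centralizer {B.exchange n} := by
    refine tailBraids_le fun j h₁ _ => ?_
    rw [Subgroup.mem_centralizer_singleton_iff]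
    have h : ∀ m ≤ 3, Commute (B.sigma n j) (B.sigma n m) := fun m hm =>
      (B.sigma_comm (by omega)).symm
    exact (((h 2 (by omega)).mul_right (h 3 (by omega))).mul_right (h 1 (by omega))).mul_right
      (h 2 (by omega))
  have h2 := Subgroup.mem_centralizer_singleton_iff.1 (h1 hc)
  rw [smul_vtx, mul_assoc, h2, ← mul_assoc,
    vtx_mul_of_mem _ (tailBraids_two_le_tauStab n (tailBraids_anti (by omega) hc)), mul_assoc]

/-! ### Standard vertices -/

theorem vtx_sigma_mul_shift_pow {j k : ℕ} (hk : k + 1 < n) (h : j ≠ k) (h' : j ≠ k + 2) :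
    B.sigma n j • vtx (B.shift n ^ k) = vtx (B.shift n ^ k) := by
  rw [smul_vtx, eq_comm, vtx_eq, ← mul_assoc]
  exact sigma_conj_shift_pow_mem_tauStab hk h h'

theorem vtx_shift_pow_succ {k : ℕ} (hk : k + 2 < n) :
    vtx (B.shift n ^ (k + 1))
      = (B.sigma n (k + 1) * B.sigma n (k + 2)) • vtx (B.shift n ^ k) := by
  have h1 := B.shift_pow_mul_sigma (n := n) (j := 1) (k := k) le_rfl (by omega)
  have h2 := B.shift_pow_mul_sigma (n := n) (j := 2) (k := k) (by omega) (by omega)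
  have h3 : vtx (B.shift n ^ k * (B.sigma n 1 * B.sigma n 2)) = vtx (B.shift n ^ k * B.shift n) := by
    rw [← vtx_mul_of_mem _ (ascending_three_mem_tauStab n), mul_assoc, ← B.shift_eq (by omega)]
  rw [pow_succ, ← h3, ← mul_assoc, h1, mul_assoc, h2, smul_vtx, mul_assoc, add_comm 1 k,
    add_comm 2 k]

theorem vtx_exchange_mul_shift_pow {k : ℕ} (hk : k + 3 < n) :
    vtx (B.shift n ^ k * B.exchange n) = vtx (B.shift n ^ (k + 2)) := by
  have : vtx (B.exchange n) = vtx (B.shift n ^ 2) := by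
    have h := vtx_shift_pow_succ (n := n) (k := 1) (by omega)
    have h' := vtx_shift_pow_succ (n := n) (k := 0) (by omega)
    norm_num at h h'
    rw [h, h', smul_smul, smul_vtx, mul_one, ← mul_assoc, B.exchange]
  rw [← smul_vtx, this, smul_vtx, pow_add]

/-- The exchange gives the case m = p + 2. The braid σ_{m+1} σ_{m+2} moves the second vertex one
step further and fixes the first, both indices being larger than p + 2. -/
theorem adj_shift_pow {p m : ℕ} (hm : p + 2 ≤ m) (h : m + 1 < n) :
    Adj (vtx (B.shift n ^ p)) (vtx (B.shift n ^ m)) := by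
  induction m, hm using Nat.le_induction with
  | base => exact ⟨by omega, _, rfl, vtx_exchange_mul_shift_pow (by omega)⟩
  | succ m hm ih =>
    have := (ih (by omega)).smul (B.sigma n (m + 1) * B.sigma n (m + 2))
    rw [← vtx_shift_pow_succ (by omega)] at this
    rwa [mul_smul, vtx_sigma_mul_shift_pow (by omega) (by omega) (by omega),
      vtx_sigma_mul_shift_pow (by omega) (by omega) (by omega)] at this

/-- The braid `σ_q σ_{q-1} ⋯ σ_{p+2} (σ_1 ⋯ σ_{n-1})^p`, which moves the first two strands to the
strands `p + 1` and `q + 1`. -/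
def pairBraid (n p q : ℕ) : B n := descending (B.sigma n) (p + 1) q * B.shift n ^ p

theorem adj_pairBraid {p q m : ℕ} (hpq : p < q) (hqm : q < m) (h : m + 1 < n) :
    Adj (vtx (pairBraid n p q)) (vtx (B.shift n ^ m)) := by
  have h1 := (adj_shift_pow (n := n) (by omega : p + 2 ≤ m) h).smul
    (descending (B.sigma n) (p + 1) q)
  have h2 : descending (B.sigma n) (p + 1) q ∈ MulAction.stabilizer (B n) (vtx (B.shift n ^ m)) :=
    descending_mem _ _ fun l h₁ h₂ =>
      vtx_sigma_mul_shift_pow (by omega) (by omega) (by omega)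
  rwa [MulAction.mem_stabilizer_iff.1 h2] at h1

theorem natPerm_descending {p q : ℕ} (h : p ≤ q) (hq : q < n) :
    B.natPerm n (descending (B.sigma n) p q) p = q ∧
      ∀ x < p, B.natPerm n (descending (B.sigma n) p q) x = x := by
  induction q, h using Nat.le_induction with
  | base => simp [descending_self]
  | succ q h ih =>
    obtain ⟨h1, h2⟩ := ih (by omega)
    rw [descending_succ _ h, map_mul]
    constructor
    · rw [Equiv.Perm.mul_apply, h1, B.natPerm_sigma (by omega)]; simp
    · intro x hx
      rw [Equiv.Perm.mul_apply, h2 x hx, natPerm_sigma_of_lt (by omega)]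

theorem natPerm_pairBraid_zero {p q : ℕ} (h : p < q) (hq : q < n) :
    B.natPerm n (pairBraid n p q) 0 = p := by
  rw [pairBraid, map_mul, Equiv.Perm.mul_apply, B.natPerm_shift_pow (by omega), zero_add,
    (natPerm_descending (by omega) hq).2 p (by omega)]

theorem natPerm_pairBraid_one {p q : ℕ} (h : p < q) (hq : q < n) :
    B.natPerm n (pairBraid n p q) 1 = q := by
  rw [pairBraid, map_mul, Equiv.Perm.mul_apply, B.natPerm_shift_pow (by omega), add_comm,
    (natPerm_descending (by omega) hq).1]

/-- The strands of the standard vertices for `D_{n,i}`. -/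
def Rep (n i : ℕ) : Type :=
  {x : ℕ × ℕ // x.1 < x.2 ∧ x.2 < n ∧ (x.2 ≤ i ∨ (x.1 = i ∧ x.2 = i + 1))}

/-- The braid of a standard vertex. -/
def Rep.braid {i : ℕ} (x : Rep n i) : B n := pairBraid n x.1.1 x.1.2

/-- Sort the two strands. If both are below i nothing is to be done; if only one is, the other is
moved to i; if neither is, they are moved to i and i + 1. -/
theorem exists_rep {i : ℕ} (hn : 1 < n) (v : Vertex n) :
    ∃ x : Rep n i, ∃ d ∈ D n i, v = d • vtx x.braid := by
  obtain ⟨b, rfl⟩ := vtx_surjective v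
  obtain ⟨b, hb, hlt⟩ := exists_vtx_eq hn b
  rw [← hb]
  clear hb
  have h1 : B.natPerm n b 1 < n := B.natPerm_lt b hn
  suffices H : ∃ x : Rep n i, ∃ d ∈ D n i, B.natPerm n d x.1.1 = B.natPerm n b 0 ∧
      B.natPerm n d x.1.2 = B.natPerm n b 1 by
    obtain ⟨x, d, hd, e0, e1⟩ := H
    refine ⟨x, vtx_orbit (b := b) (b' := x.braid) hd fun y hy => ?_⟩
    rw [map_mul, Equiv.Perm.mul_apply, Rep.braid]
    obtain rfl | rfl : y = 0 ∨ y = 1 := by omega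
    · rw [natPerm_pairBraid_zero x.2.1 x.2.2.1, e0]
    · rw [natPerm_pairBraid_one x.2.1 x.2.2.1, e1]
  generalize B.natPerm n b 0 = p at *
  generalize B.natPerm n b 1 = q at *
  rcases lt_or_ge p i with hp | hp
  · rcases lt_or_ge q i with hq | hq
    · exact ⟨⟨(p, q), hlt, h1, Or.inl hq.le⟩, 1, one_mem _, by simp, by simp⟩
    · obtain ⟨c, hc, e⟩ := exists_tailBraids_apply hq h1
      exact ⟨⟨(p, i), hp, by simp only; omega, Or.inl le_rfl⟩, c, tailBraids_le_D _ _ hc,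
        mem_D.1 (tailBraids_le_D _ _ hc) p hp, e⟩
  · obtain ⟨c, hc, e⟩ := exists_tailBraids_apply_eq (n := n) 2 i (fun x => if x = 0 then p else q)
      (fun x _ => by split_ifs <;> omega)
      (fun x hx y hy hxy => by simp only [Set.mem_Iio] at hx hy; grind)
    exact ⟨⟨(i, i + 1), by simp, by simp only; omega, Or.inr ⟨rfl, rfl⟩⟩, c,
      tailBraids_le_D _ _ hc, by simpa using e 0 (by omega), by simpa using e 1 (by omega)⟩

/-- D_{n,i} fixes each strand below i and preserves the set of the others, so the strands below i
can be read off from the orbit. They determine the standard pair. -/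
theorem rep_unique {i : ℕ} (hn : 1 < n) {x y : Rep n i} {d d' : B n} (hd : d ∈ D n i)
    (hd' : d' ∈ D n i) (h : d • vtx x.braid = d' • vtx y.braid) : x = y := by
  have h1 := natPerm_of_vtx_eq hn (b := d * x.braid) (b' := d' * y.braid) h
  simp only [map_mul, Equiv.Perm.mul_apply, Rep.braid, natPerm_pairBraid_zero x.2.1 x.2.2.1,
    natPerm_pairBraid_one x.2.1 x.2.2.1, natPerm_pairBraid_zero y.2.1 y.2.2.1,
    natPerm_pairBraid_one y.2.1 y.2.2.1] at h1
  obtain ⟨⟨p, q⟩, hx⟩ := x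
  obtain ⟨⟨r, s⟩, hy⟩ := y
  simp only at hx hy h1
  have key : ∀ d ∈ D n i, ∀ x, (x < i ∧ B.natPerm n d x = x) ∨ (i ≤ x ∧ i ≤ B.natPerm n d x) := by
    intro d hd x
    rcases lt_or_ge x i with h | h
    · exact Or.inl ⟨h, mem_D.1 hd x h⟩
    · exact Or.inr ⟨h, le_natPerm hd h⟩
  have k1 := key d hd p
  have k2 := key d hd q
  have k3 := key d' hd' r
  have k4 := key d' hd' s
  have : p = r ∧ q = s := by omega
  obtain ⟨rfl, rfl⟩ := this
  rfl

end Vertices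

/-! ### The presented group -/

/-- The words of the eight forms that represent `1` in `SG_n`. -/
def relators (n i : ℕ) : Set (FreeGroup (SGDGen n i)) :=
  {r | RelatorForm n i r ∧ FreeGroup.lift SGDGen.toSG r = 1}

/-- The group presented by the words of the eight forms that represent `1` in `SG_n`. -/
abbrev Pres (n i : ℕ) : Type := PresentedGroup (relators n i)

/-- The element of the presented group represented by a word. -/
abbrev Pres.mk (n i : ℕ) : FreeGroup (SGDGen n i) →* Pres n i := PresentedGroup.mk (relators n i)

/-- The homomorphism from the presented group to `SG_n`. -/
def Pres.toSG (n i : ℕ) : Pres n i →* SG n := PresentedGroup.toGroup fun _ hr => hr.2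

section Presentation

variable {n i : ℕ}

theorem Pres.toSG_mk (w : FreeGroup (SGDGen n i)) :
    Pres.toSG n i (Pres.mk n i w) = FreeGroup.lift SGDGen.toSG w := rfl

theorem Pres.toSG_of (g : SGDGen n i) : Pres.toSG n i (Pres.mk n i (FreeGroup.of g)) = g.toSG :=
  FreeGroup.lift_apply_of

/-- A word of an admitted form is a relator as soon as it holds in SG_n. Commutations of these forms
can therefore be verified in SG_n. -/
theorem Pres.commute {u v : FreeGroup (SGDGen n i)} (h : RelatorForm n i (commRel u v))
    (huv : Commute (Pres.toSG n i (Pres.mk n i u)) (Pres.toSG n i (Pres.mk n i v))) :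
    Commute (Pres.mk n i u) (Pres.mk n i v) := by
  have : Pres.mk n i (commRel u v) = 1 := by
    apply PresentedGroup.one_of_mem
    refine ⟨h, ?_⟩
    rw [← Pres.toSG_mk, commRel, rel, map_mul, map_inv, map_mul, map_inv, mul_inv_eq_one,
      map_mul, map_mul, map_mul, map_mul]
    exact huv
  rwa [commRel, rel, map_mul, map_inv, mul_inv_eq_one, map_mul, map_mul] at this

theorem Pres.toSG_inclD (w : FreeGroup (DGen n i)) :
    Pres.toSG n i (Pres.mk n i (inclD w)) = B.toSG n (evalB w) := by
  have : ((Pres.toSG n i).comp (Pres.mk n i)).comp inclD = (B.toSG n).comp evalB := by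
    ext d
    rw [MonoidHom.comp_apply, MonoidHom.comp_apply, MonoidHom.comp_apply, inclD,
      FreeGroup.map.of, Pres.toSG_of, evalB, FreeGroup.lift_apply_of]
    rcases d with ⟨k, j, h⟩ | ⟨j, h⟩
    · simp only [SGDGen.toSG, DGen.toB, aElt, map_mul, map_inv, map_pow, map_ascending,
        B.toSG_sigma]
    · simp only [SGDGen.toSG, DGen.toB, B.toSG_sigma]
  exact DFunLike.congr_fun this w

/-! ### The subgroup of the last strands -/

/-- The map on words induced by the inclusion of the generators. -/
def singIncl {m n : ℕ} (h : m ≤ n) : FreeGroup (SingGen m) →* FreeGroup (SingGen n) :=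
  FreeGroup.map fun x => match x with
    | .sigma j h' => .sigma j (by omega)
    | .tau h' => .tau (by omega)

theorem singIncl_word {m n j : ℕ} (h : m ≤ n) (hj : 1 ≤ j) (hjm : j < m) :
    singIncl h (SingGen.word m j) = SingGen.word n j := by
  rw [SingGen.word, SingGen.word, dif_pos ⟨hj, hjm⟩, dif_pos (by omega), singIncl,
    FreeGroup.map.of]

theorem singIncl_tauWord {m n : ℕ} (h : m ≤ n) (hm : 1 < m) :
    singIncl h (SingGen.tauWord m) = SingGen.tauWord n := by
  rw [SingGen.tauWord, SingGen.tauWord, dif_pos hm, dif_pos (by omega), singIncl,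
    FreeGroup.map.of]

theorem singIncl_rel {m n : ℕ} (h : m ≤ n) {r : FreeGroup (SingGen m)} (hr : SingRel m r) :
    SingRel n (singIncl h r) := by
  rcases hr with ⟨j, h₁, h₂⟩ | ⟨j, k, h₁, h₂, h₃⟩ | ⟨h'⟩ | ⟨j, h₁, h₂, h₃⟩ | ⟨h'⟩
  · simp only [rel, map_mul, map_inv]
    rw [singIncl_word h (by omega) (by omega), singIncl_word h (by omega) (by omega)]
    exact .braid j h₁ (by omega)
  · simp only [rel, map_mul, map_inv]
    rw [singIncl_word h (by omega) (by omega), singIncl_word h (by omega) (by omega)]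
    exact .comm j k h₁ h₂ (by omega)
  · simp only [rel, map_mul, map_inv, map_pow]
    rw [singIncl_word h (by omega) (by omega), singIncl_word h (by omega) (by omega),
      singIncl_tauWord h (by omega)]
    exact .tau_pure (by omega)
  · simp only [rel, map_mul, map_inv]
    rw [singIncl_word h (by omega) (by omega), singIncl_tauWord h (by omega)]
    exact .tau_sigma j h₁ (by omega) h₃
  · simp only [rel, map_mul, map_inv]
    rw [singIncl_word h (by omega) (by omega), singIncl_word h (by omega) (by omega),
      singIncl_word h (by omega) (by omega), singIncl_tauWord h (by omega)]
    exact .tau_tau (by omega)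

/-- Renaming σ_j to σ_{j+i} and τ_1 to τ_{i+1} is conjugation by the i-th power of the shift. Hence
the relators carried over from SG_{n-i} hold in SG_n. -/
theorem lift_map_phiGen (r : FreeGroup (SingGen (n - i))) :
    FreeGroup.lift SGDGen.toSG (FreeGroup.map (phiGen (n := n) (i := i)) r)
      = MulAut.conj (B.toSG n (B.shift n ^ i))
        (PresentedGroup.mk {r | SingRel n r} (singIncl (Nat.sub_le n i) r)) := by
  have : (FreeGroup.lift SGDGen.toSG).comp (FreeGroup.map (phiGen (n := n) (i := i)))
      = (MulAut.conj (B.toSG n (B.shift n ^ i))).toMonoidHom.comp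
        ((PresentedGroup.mk {r | SingRel n r}).comp (singIncl (Nat.sub_le n i))) := by
    ext x
    simp only [MonoidHom.comp_apply, FreeGroup.map.of, FreeGroup.lift_apply_of, singIncl,
      MulEquiv.coe_toMonoidHom, MulAut.conj_apply]
    rcases x with ⟨j, h⟩ | ⟨h⟩
    · have e := congrArg (B.toSG n) (B.shift_pow_mul_sigma (n := n) (j := j) (k := i) h.1
        (by omega))
      rw [map_mul, map_mul, B.toSG_sigma, B.toSG_sigma] at e
      have e' : SG.sigma n j = PresentedGroup.mk {r | SingRel n r}
          (FreeGroup.of (.sigma j (by omega))) := by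
        rw [SG.sigma, SingGen.word, dif_pos (by omega)]
      rw [← e', e, mul_inv_cancel_right]
      rfl
    · have e := SG.tau_succ (n := n) (k := i) (by omega)
      have e' : SG.tau n 1 = PresentedGroup.mk {r | SingRel n r}
          (FreeGroup.of (.tau (by omega))) := by
        rw [SG.tau, SingGen.tauWord, dif_pos (by omega)]
      rw [← e', ← e]
      rfl
  exact DFunLike.congr_fun this r

/-- The homomorphism `SG_{n-i} → SGD_{n,i}`, lifted to the presented group. -/
def phi (n i : ℕ) : SG (n - i) →* Pres n i :=
  PresentedGroup.toGroup (f := fun g => Pres.mk n i (FreeGroup.of (phiGen g))) (by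
    intro r hr
    have : Pres.mk n i (FreeGroup.map phiGen r) = 1 := by
      apply PresentedGroup.one_of_mem
      refine ⟨.fromSG r hr, ?_⟩
      rw [lift_map_phiGen, PresentedGroup.one_of_mem (rels := {r | SingRel n r})
        (singIncl_rel _ hr), map_one]
    rw [← this]
    have : FreeGroup.lift (fun g => Pres.mk n i (FreeGroup.of (phiGen g)))
        = (Pres.mk n i).comp (FreeGroup.map phiGen) := by
      ext x
      simp
    rw [this]
    rfl)

/-- The element of `D_{n,i}` represented by a word. -/
def evalD (n i : ℕ) : FreeGroup (DGen n i) →* D n i :=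
  evalB.codRestrict (D n i) fun w => range_evalB_le n i ⟨w, rfl⟩

theorem coe_evalD (w : FreeGroup (DGen n i)) : (evalD n i w : B n) = evalB w := rfl

theorem evalD_surjective (hi : i < n) : Function.Surjective (evalD n i) := by
  rintro ⟨d, hd⟩
  obtain ⟨w, rfl⟩ := D_le_range_evalB hi hd
  exact ⟨w, rfl⟩

/-- The homomorphism from `D_{n,i}` to the presented group. -/
noncomputable def fromD (hi : i < n) : D n i →* Pres n i :=
  (evalD n i).liftOfSurjective (evalD_surjective hi) ⟨(Pres.mk n i).comp inclD, by
    intro w hw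
    have hw' : evalB w = 1 := congrArg Subtype.val (MonoidHom.mem_ker.1 hw)
    rw [MonoidHom.mem_ker, MonoidHom.comp_apply]
    apply PresentedGroup.one_of_mem
    refine ⟨.fromD w hw', ?_⟩
    rw [← Pres.toSG_mk, Pres.toSG_inclD, hw', map_one]⟩

variable (hi : i < n)

theorem fromD_evalD (w : FreeGroup (DGen n i)) :
    fromD hi (evalD n i w) = Pres.mk n i (inclD w) :=
  MonoidHom.liftOfRightInverse_comp_apply _ _ _ _ _

theorem toSG_fromD (d : D n i) : Pres.toSG n i (fromD hi d) = B.toSG n d := by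
  obtain ⟨w, rfl⟩ := evalD_surjective hi d
  rw [fromD_evalD, Pres.toSG_inclD, coe_evalD]

theorem fromD_sigma {j : ℕ} (h : i < j ∧ j < n) :
    fromD hi ⟨B.sigma n j, sigma_mem_D h.1⟩ = Pres.mk n i (sLetter j h) := by
  have : evalD n i (FreeGroup.of (.sigma j h)) = ⟨B.sigma n j, sigma_mem_D h.1⟩ :=
    Subtype.ext FreeGroup.lift_apply_of
  rw [← this, fromD_evalD, inclD, FreeGroup.map.of, sLetter]

theorem phi_sigma {j : ℕ} (h : 1 ≤ j ∧ j < n - i) :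
    phi n i (SG.sigma (n - i) j) = fromD hi ⟨B.sigma n (j + i), sigma_mem_D (by omega)⟩ := by
  rw [fromD_sigma hi (by omega), SG.sigma, SingGen.word, dif_pos h]
  exact PresentedGroup.toGroup.of _

theorem phi_tau (h : i + 1 < n) : phi n i (SG.tau (n - i) 1) = Pres.mk n i (tLetter h) := by
  rw [SG.tau, SingGen.tauWord, dif_pos (by omega)]
  exact PresentedGroup.toGroup.of _

/-! ### The generators of the standard vertices -/

/-- The element of the presented group that belongs to a standard vertex. -/
def repElt (x : Rep n i) : Pres n i :=
  if h : x.1.2 ≤ i then Pres.mk n i (xLetter (x.1.1 + 1) x.1.2 ⟨by omega, x.2.1, h⟩)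
  else phi n i (SG.zeta (n - i))

theorem repElt_of_le (x : Rep n i) (h : x.1.2 ≤ i) :
    repElt x = Pres.mk n i (xLetter (x.1.1 + 1) x.1.2 ⟨by omega, x.2.1, h⟩) := dif_pos h

theorem repElt_of_not_le (x : Rep n i) (h : ¬ x.1.2 ≤ i) :
    repElt x = phi n i (SG.zeta (n - i)) := dif_neg h

theorem phi_zeta (h : i + 1 < n) : phi n i (SG.zeta (n - i))
    = fromD hi ⟨B.sigma n (i + 1), sigma_mem_D (by omega)⟩ * Pres.mk n i (tLetter h) := by
  rw [SG.zeta, map_mul, phi_sigma hi (by omega), phi_tau h]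
  congr 4
  rw [add_comm]

theorem Rep.braid_of_not_le {x : Rep n i} (h : ¬ x.1.2 ≤ i) :
    i + 1 < n ∧ x.braid = B.shift n ^ i := by
  have h1 := x.2.2.2.resolve_left h
  refine ⟨h1.2 ▸ x.2.2.1, ?_⟩
  rw [Rep.braid, pairBraid, h1.1, h1.2, descending_self, one_mul]

include hi in
theorem toSG_repElt (x : Rep n i) : Pres.toSG n i (repElt x) = conjZeta x.braid := by
  by_cases h : x.1.2 ≤ i
  · rw [repElt_of_le x h, xLetter, Pres.toSG_of, SGDGen.toSG, xElt,
      SG.sigma_mul_tau (by have := x.2; omega), conjZeta, Rep.braid, pairBraid, map_mul,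
      map_descending]
    simp only [B.toSG_sigma]
    group
  · obtain ⟨h1, h2⟩ := Rep.braid_of_not_le h
    rw [repElt_of_not_le x h, phi_zeta hi h1, h2, map_mul, toSG_fromD, tLetter, Pres.toSG_of,
      SGDGen.toSG, B.toSG_sigma, SG.sigma_mul_tau h1, conjZeta]

theorem conjZeta_commute {b c : B n} (h : c • vtx b = vtx b) :
    Commute (B.toSG n c) (conjZeta b) := by
  have := conjZeta_congr (b := c * b) (b' := b) h
  rw [conjZeta_mul] at this
  exact mul_inv_eq_iff_eq_mul.1 this

/-- An element that commutes with the pure braids and the braids on the last strands that it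
should commute with. -/
theorem commute_fromD_of_natPerm {y : Pres n i} {m : ℕ} (hm : i ≤ m)
    (hpure : ∀ d : D n i, (d : B n) ∈ P n → Commute (B.toSG n d) (Pres.toSG n i y) →
      Commute (fromD hi d) y)
    (htail : ∀ j (h : m < j), j < n →
      Commute (fromD hi ⟨B.sigma n j, sigma_mem_D (by omega)⟩) y)
    {d : D n i} (hd : (d : B n) ∈ D n m) (hdy : Commute (B.toSG n d) (Pres.toSG n i y)) :
    Commute (fromD hi d) y := by
  have h1 : tailBraids n m
      ≤ ((Subgroup.centralizer {y}).comap (fromD hi)).map (D n i).subtype := by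
    refine tailBraids_le fun j h₁ h₂ => ?_
    refine ⟨⟨B.sigma n j, sigma_mem_D (by omega)⟩, ?_, rfl⟩
    rw [SetLike.mem_coe, Subgroup.mem_comap, Subgroup.mem_centralizer_singleton_iff]
    exact htail j h₁ h₂
  obtain ⟨c, hc, e⟩ := exists_tailBraids_natPerm hd
  obtain ⟨c, hc', rfl⟩ := h1 hc
  rw [SetLike.mem_coe, Subgroup.mem_comap, Subgroup.mem_centralizer_singleton_iff] at hc'
  replace hc' : Commute (fromD hi c) y := hc'
  -- `d` and `c` have the same permutation, so the quotient is pure. It commutes with the image of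
  -- `y` in SG_n because `d` does by assumption and `c` already does in the presented group.
  have h2 := hpure (d * c⁻¹) (by
    rw [B.mem_P, Subgroup.coe_mul, Subgroup.coe_inv, map_mul, map_inv, ← e]
    simp) (by
    rw [Subgroup.coe_mul, Subgroup.coe_inv, map_mul, map_inv]
    refine hdy.mul_left (Commute.inv_left ?_)
    rw [← toSG_fromD hi]
    exact hc'.map _)
  have h3 := h2.mul_left hc'
  rwa [← map_mul, inv_mul_cancel_right] at h3

theorem sigma_smul_pairBraid {p q j : ℕ} (h : p < q) (hq : q < n) (hj : q + 1 < j) :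
    B.sigma n j • vtx (pairBraid n p q) = vtx (pairBraid n p q) := by
  have h1 : descending (B.sigma n) (p + 1) q ∈ Subgroup.centralizer {B.sigma n j} :=
    descending_mem _ _ fun l h₁ h₂ => by
      rw [Subgroup.mem_centralizer_singleton_iff]
      exact B.sigma_comm (by omega)
  rw [Subgroup.mem_centralizer_singleton_iff] at h1
  rw [pairBraid, smul_vtx, ← mul_assoc, ← h1, mul_assoc, ← smul_vtx, ← smul_vtx,
    vtx_sigma_mul_shift_pow (by omega) (by omega) (by omega), smul_vtx]

theorem sigma_commute_repElt {x : Rep n i} (h : x.1.2 ≤ i) {j : ℕ} (hj : x.1.2 + 1 < j)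
    (hij : i < j ∧ j < n) :
    Commute (fromD hi ⟨B.sigma n j, sigma_mem_D hij.1⟩) (repElt x) := by
  have h1 := conjZeta_commute (sigma_smul_pairBraid x.2.1 x.2.2.1 hj)
  have h2 := toSG_repElt hi x
  have h3 := toSG_fromD hi ⟨B.sigma n j, sigma_mem_D hij.1⟩
  rw [repElt_of_le x h] at h2 ⊢
  rw [fromD_sigma hi hij] at h3 ⊢
  refine (Pres.commute (.X_sigma _ _ _ j hij) ?_).symm
  rw [h2, h3]
  exact h1.symm

/-- The stabilizer of a standard vertex in `D_{n,i}` commutes with its generator. -/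
theorem fromD_commute_repElt (hn : 1 < n) {x : Rep n i} {d : D n i}
    (h : (d : B n) • vtx x.braid = vtx x.braid) : Commute (fromD hi d) (repElt x) := by
  have hperm := natPerm_of_vtx_eq hn (b := d * x.braid) (b' := x.braid) h
  simp only [map_mul, Equiv.Perm.mul_apply, Rep.braid, natPerm_pairBraid_zero x.2.1 x.2.2.1,
    natPerm_pairBraid_one x.2.1 x.2.2.1] at hperm
  have hd := mem_D.1 d.2
  by_cases hx : x.1.2 ≤ i
  -- The only strand below this bound that is not below i is the second strand of `x`, when it
  -- equals i. As `d` fixes the first strand and preserves the pair, it fixes that one too.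
  · apply commute_fromD_of_natPerm hi (m := max i (x.1.2 + 1)) (by omega)
    · intro d hdP hd
      obtain ⟨w, rfl⟩ := evalD_surjective hi d
      rw [← toSG_fromD hi] at hd
      rw [fromD_evalD, repElt_of_le x hx] at hd ⊢
      exact (Pres.commute (.X_pure _ _ _ w hdP) hd.symm).symm
    · intro j h₁ h₂
      exact sigma_commute_repElt hi hx (by omega) ⟨by omega, h₂⟩
    · rw [mem_D]
      intro y hy
      rcases lt_or_ge y i with hy' | hy'
      · exact hd y hy'
      · obtain rfl : y = x.1.2 := by omega
        have := hd x.1.1 (by have := x.2.1; omega)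
        have := x.2.1
        omega
    · rw [toSG_repElt hi]
      exact conjZeta_commute h
  · obtain ⟨h1, h2⟩ := Rep.braid_of_not_le hx
    have hpq : x.1.1 = i ∧ x.1.2 = i + 1 := by have := x.2; omega
    rw [hpq.1, hpq.2] at hperm
    rw [h2, smul_vtx, eq_comm, vtx_eq, mem_tauStab, ← mul_assoc] at h
    have hs : Commute (d : B n) (B.sigma n (i + 1)) := by
      rw [B.sigma_succ h1, ← Commute.conj_iff (B.shift n ^ i)⁻¹]
      convert h.1 using 1 <;> group
    have ht : Commute (B.toSG n d) (SG.tau n (i + 1)) := by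
      rw [SG.tau_succ h1, ← Commute.conj_iff (B.toSG n (B.shift n ^ i))⁻¹]
      convert h.2 using 1
      · simp only [map_mul, map_inv]; group
      · group
    rw [repElt_of_not_le x hx, phi_zeta hi h1]
    set s : D n i := ⟨B.sigma n (i + 1), sigma_mem_D (by omega)⟩
    have hs' : Commute d s := Subtype.ext hs
    refine (hs'.map (fromD hi)).mul_right ?_
    have hst : Commute (fromD hi s) (Pres.mk n i (tLetter h1)) := by
      have := (SG.sigma_tau_one (n := n - i) (j := 1) (by omega)).map (phi n i)
      rw [phi_sigma hi (by omega), phi_tau h1] at this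
      convert this using 4
      rw [add_comm]
    have hqt : Pres.toSG n i (Pres.mk n i (tLetter h1)) = SG.tau n (i + 1) := Pres.toSG_of _
    -- If both strands of the pair are fixed, form 6 handles the pure part, and the relations of
    -- SG_{n-i} between τ_1 and σ_j with j > 2 handle the braids on the strands behind the pair.
    have key : ∀ d : D n i, (d : B n) ∈ D n (i + 2) → Commute (B.toSG n d) (SG.tau n (i + 1)) →
        Commute (fromD hi d) (Pres.mk n i (tLetter h1)) := by
      intro d hd hdt
      apply commute_fromD_of_natPerm hi (m := i + 2) (by omega) _ _ hd (by rwa [hqt])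
      · intro d hdP hd
        obtain ⟨w, rfl⟩ := evalD_surjective hi d
        rw [← toSG_fromD hi] at hd
        rw [fromD_evalD] at hd ⊢
        exact (Pres.commute (.tau_pure _ w hdP) hd.symm).symm
      · intro j h₁ h₂
        have := (SG.sigma_tau_one (n := n - i) (j := j - i) (by omega)).map (phi n i)
        rw [phi_sigma hi (by omega), phi_tau h1] at this
        convert this using 4
        omega
    rcases hperm with hperm | hperm
    · apply key d _ ht
      rw [mem_D]
      intro y hy
      rcases lt_or_ge y i with hy' | hy'
      · exact hd y hy'
      · obtain rfl | rfl : y = i ∨ y = i + 1 := by omega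
        · exact hperm.1.symm
        · exact hperm.2.symm
    -- Here `d` interchanges the two strands; multiplication by σ_{i+1}, which commutes with τ_{i+1}
    -- in the presented group, reduces to the case in which they are fixed.
    · have h3 := key (d * s) (by
        rw [mem_D]
        intro y hy
        rw [Subgroup.coe_mul, map_mul, Equiv.Perm.mul_apply, B.natPerm_sigma (by omega)]
        rcases lt_or_ge y i with hy' | hy'
        · rw [Equiv.swap_apply_of_ne_of_ne (by omega) (by omega)]
          exact hd y hy'
        · obtain rfl | rfl : y = i ∨ y = i + 1 := by omega
          · simp [← hperm.1]
          · simp [← hperm.2]) (by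
        rw [Subgroup.coe_mul, map_mul]
        refine ht.mul_left ?_
        rw [← toSG_fromD hi, ← hqt]
        exact hst.map _)
      have h4 := h3.mul_left hst.inv_left
      rwa [← map_inv, ← map_mul, mul_inv_cancel_right] at h4

/-! ### The elements of the presented group that belong to vertices -/

/-- Two ways to reach `v` start from the same standard vertex by `rep_unique` and differ by an
element of its stabilizer, which commutes with `repElt`. -/
theorem exists_vertexElt (hn : 1 < n) (v : Vertex n) :
    ∃ y : Pres n i, ∀ (d : D n i) (x : Rep n i), v = (d : B n) • vtx x.braid →
      y = fromD hi d * repElt x * (fromD hi d)⁻¹ := by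
  obtain ⟨x, d, hd, rfl⟩ := exists_rep (i := i) hn v
  refine ⟨fromD hi ⟨d, hd⟩ * repElt x * (fromD hi ⟨d, hd⟩)⁻¹, fun d' x' h => ?_⟩
  obtain rfl := rep_unique hn hd d'.2 h
  have h1 := fromD_commute_repElt hi hn (x := x) (d := d'⁻¹ * ⟨d, hd⟩) (by
    rw [Subgroup.coe_mul, mul_smul, h, Subgroup.coe_inv, inv_smul_smul])
  rw [map_mul, map_inv] at h1
  rw [mul_inv_eq_iff_eq_mul]
  calc _ = fromD hi d' * ((fromD hi d')⁻¹ * fromD hi ⟨d, hd⟩ * repElt x) := by group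
    _ = _ := by rw [h1.eq]; group

/-- The element of the presented group that belongs to a vertex. -/
noncomputable def vertexElt (hn : 1 < n) (v : Vertex n) : Pres n i := (exists_vertexElt hi hn v).choose

variable (hn : 1 < n)

theorem vertexElt_rep (d : D n i) (x : Rep n i) :
    vertexElt hi hn ((d : B n) • vtx x.braid) = fromD hi d * repElt x * (fromD hi d)⁻¹ :=
  (exists_vertexElt hi hn _).choose_spec d x rfl

theorem vertexElt_braid (x : Rep n i) : vertexElt hi hn (vtx x.braid) = repElt x := by
  have := vertexElt_rep hi hn 1 x
  simpa using this

theorem vertexElt_smul (d : D n i) (v : Vertex n) :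
    vertexElt hi hn ((d : B n) • v) = fromD hi d * vertexElt hi hn v * (fromD hi d)⁻¹ := by
  obtain ⟨x, d', hd', rfl⟩ := exists_rep (i := i) hn v
  have h1 := vertexElt_rep hi hn (d * ⟨d', hd'⟩) x
  have h2 := vertexElt_rep hi hn ⟨d', hd'⟩ x
  rw [h2, smul_smul]
  rw [Subgroup.coe_mul] at h1
  rw [h1, map_mul]
  group

theorem toSG_vertexElt (b : B n) : Pres.toSG n i (vertexElt hi hn (vtx b)) = conjZeta b := by
  obtain ⟨x, d, hd, h⟩ := exists_rep (i := i) hn (vtx b)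
  have h2 := vertexElt_rep hi hn ⟨d, hd⟩ x
  rw [h, h2, map_mul, map_mul, map_inv, toSG_fromD, toSG_repElt hi, ← conjZeta_mul]
  exact (conjZeta_congr h).symm

end Presentation

/-! ### Adjacent vertices commute in the presented group -/

section Adjacent

variable {n i : ℕ}

theorem Adj.symm {v v' : Vertex n} (h : Adj v v') : Adj v' v := by
  obtain ⟨hn, b, rfl, rfl⟩ := h
  refine ⟨hn, b * B.exchange n, rfl, ?_⟩
  rw [mul_assoc, ← pow_two, vtx_mul_of_mem _ (exchange_sq_mem_tauStab hn)]

/-- Adjacent vertices whose strands correspond under `D_{n,i}` form one orbit. -/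
theorem Adj.exists_smul {u u' v v' : Vertex n} {b b' : B n} (hu : vtx b = u)
    (hu' : vtx (b * B.exchange n) = u') (hv : vtx b' = v) (hv' : vtx (b' * B.exchange n) = v')
    {c : B n} (hc : c ∈ D n i)
    (h : ∀ x < 4, B.natPerm n b' x = B.natPerm n c (B.natPerm n b x)) :
    ∃ d : D n i, v = (d : B n) • u ∧ v' = (d : B n) • u' := by
  obtain ⟨d, hd, h1, h2⟩ := adj_orbit (b := b') (b' := b) hc fun x hx => by
    rw [map_mul, Equiv.Perm.mul_apply, h x hx]
  rw [hu, hv] at h1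
  rw [hu', hv'] at h2
  exact ⟨⟨d, hd⟩, h1, h2⟩

variable (hi : i < n) (hn : 1 < n)

theorem commute_vertexElt_smul {d : D n i} {v v' : Vertex n}
    (h : Commute (vertexElt hi hn v) (vertexElt hi hn v')) :
    Commute (vertexElt hi hn ((d : B n) • v)) (vertexElt hi hn ((d : B n) • v')) := by
  rw [vertexElt_smul, vertexElt_smul]
  exact (Commute.conj_iff _).2 h

theorem Adj.commute_toSG {v v' : Vertex n} (h : Adj v v') :
    Commute (Pres.toSG n i (vertexElt hi hn v)) (Pres.toSG n i (vertexElt hi hn v')) := by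
  obtain ⟨b, rfl⟩ := vtx_surjective v
  obtain ⟨b', rfl⟩ := vtx_surjective v'
  rw [toSG_vertexElt, toSG_vertexElt]
  exact h.commute

/-- A word for `d` makes this literally a relator of form 8, and adjacency shows that it holds in
SG_n. No classification of orbits is needed here. -/
theorem commute_of_lt {x y : Rep n i} (hx : x.1.2 ≤ i) (hy : y.1.2 ≤ i) (hxy : x.1.1 < y.1.1)
    {d : D n i} (h : Adj (vtx x.braid) ((d : B n) • vtx y.braid)) :
    Commute (vertexElt hi hn (vtx x.braid)) (vertexElt hi hn ((d : B n) • vtx y.braid)) := by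
  have h1 := h.commute_toSG hi hn
  rw [vertexElt_rep, vertexElt_braid, repElt_of_le x hx, repElt_of_le y hy] at h1 ⊢
  obtain ⟨w, rfl⟩ := evalD_surjective hi d
  rw [fromD_evalD, ← map_inv, ← map_mul, ← map_mul] at h1 ⊢
  exact Pres.commute (.X_X_conj _ _ _ _ _ _ (by omega) w) h1

/-- Both vertices involve one of the first `i` strands. -/
theorem commute_of_le {x y : Rep n i} (hx : x.1.2 ≤ i) (hy : y.1.2 ≤ i) {d d' : D n i}
    (h : Adj ((d : B n) • vtx x.braid) ((d' : B n) • vtx y.braid)) :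
    Commute (vertexElt hi hn ((d : B n) • vtx x.braid))
      (vertexElt hi hn ((d' : B n) • vtx y.braid)) := by
  -- Adjacent vertices use four different strands, and the smaller strand of each pair lies below i
  -- and is fixed by `d` and `d'`. Form 8 needs the strict inequality.
  have hne : x.1.1 ≠ y.1.1 := by
    obtain ⟨h3, b, h1, h2⟩ := h
    have h1' := natPerm_of_vtx_eq hn (b' := (d : B n) * x.braid) h1
    have h2' := natPerm_of_vtx_eq hn (b' := (d' : B n) * y.braid) h2
    simp only [map_mul, Equiv.Perm.mul_apply, Rep.braid, natPerm_pairBraid_zero x.2.1 x.2.2.1,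
      natPerm_pairBraid_one x.2.1 x.2.2.1, natPerm_pairBraid_zero y.2.1 y.2.2.1,
      natPerm_pairBraid_one y.2.1 y.2.2.1, natPerm_exchange_zero h3,
      natPerm_exchange_one h3] at h1' h2'
    have e1 := mem_D.1 d.2 x.1.1 (by have := x.2.1; omega)
    have e2 := mem_D.1 d'.2 y.1.1 (by have := y.2.1; omega)
    have n1 := (B.natPerm n b).injective.ne (show 0 ≠ 2 by omega)
    have n2 := (B.natPerm n b).injective.ne (show 0 ≠ 3 by omega)
    have n3 := (B.natPerm n b).injective.ne (show 1 ≠ 2 by omega)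
    have n4 := (B.natPerm n b).injective.ne (show 1 ≠ 3 by omega)
    omega
  have key : ∀ {x y : Rep n i} {d d' : D n i}, x.1.2 ≤ i → y.1.2 ≤ i → x.1.1 < y.1.1 →
      Adj ((d : B n) • vtx x.braid) ((d' : B n) • vtx y.braid) →
      Commute (vertexElt hi hn ((d : B n) • vtx x.braid))
      (vertexElt hi hn ((d' : B n) • vtx y.braid)) := by
    intro x y d d' hx hy hlt h
    have h' := h.smul (d : B n)⁻¹
    rw [inv_smul_smul, smul_smul] at h'
    have := commute_vertexElt_smul hi hn (d := d) (commute_of_lt hi hn (d := d⁻¹ * d') hx hy hlt h')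
    rw [Subgroup.coe_mul, Subgroup.coe_inv, mul_smul, smul_inv_smul] at this
    exact this
  rcases hne.lt_or_gt with hlt | hlt
  · exact key hx hy hlt h
  · exact (key hy hx hlt h.symm).symm

/-- Neither vertex involves one of the first `i` strands. -/
theorem commute_tail_tail {x y : Rep n i} (hx : ¬ x.1.2 ≤ i) (hy : ¬ y.1.2 ≤ i) {d d' : D n i}
    (h : Adj ((d : B n) • vtx x.braid) ((d' : B n) • vtx y.braid)) :
    Commute (vertexElt hi hn ((d : B n) • vtx x.braid))
      (vertexElt hi hn ((d' : B n) • vtx y.braid)) := by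
  obtain ⟨b, h1, h2, h3, h4⟩ := h.exists_vtx
  have hn3 := h.1
  obtain ⟨hin, ex⟩ := Rep.braid_of_not_le hx
  obtain ⟨-, ey⟩ := Rep.braid_of_not_le hy
  have h1' := natPerm_of_vtx_eq hn (b' := (d : B n) * x.braid) h1
  have h2' := natPerm_of_vtx_eq hn (b' := (d' : B n) * y.braid) h2
  simp only [map_mul, Equiv.Perm.mul_apply, ex, ey, natPerm_exchange_zero hn3,
    natPerm_exchange_one hn3] at h1' h2'
  rw [B.natPerm_shift_pow (by omega), B.natPerm_shift_pow (by omega), zero_add,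
    add_comm 1 i] at h1' h2'
  have e1 := le_natPerm d.2 (le_refl i)
  have e2 := le_natPerm d.2 (Nat.le_succ i)
  have e3 := le_natPerm d'.2 (le_refl i)
  have e4 := le_natPerm d'.2 (Nat.le_succ i)
  have hlt : ∀ x < 4, i ≤ B.natPerm n b x ∧ B.natPerm n b x < n := by
    intro x hx
    refine ⟨?_, B.natPerm_lt b (by omega)⟩
    simp only [Nat.succ_eq_add_one] at e2 e4
    obtain rfl | rfl | rfl | rfl : x = 0 ∨ x = 1 ∨ x = 2 ∨ x = 3 := by omega
    all_goals omega
  -- Four different strands lie in {i, …, n - 1}; so SG_{n-i} has its relation with two letters τ_1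
  -- on each side.
  have hin3 : i + 3 < n := by
    by_contra! hcon
    have hmaps : Set.MapsTo (B.natPerm n b) (Finset.range 4) (Finset.Ico i n) := by
      intro x hx
      simpa using hlt x (by simpa using hx)
    have := Finset.card_le_card_of_injOn _ hmaps (B.natPerm n b).injective.injOn
    simp at this
    omega
  obtain ⟨c, hc, ec⟩ := exists_tailBraids_apply_eq (n := n) 4 i (B.natPerm n b) hlt
    (B.natPerm n b).injective.injOn
  -- Up to D_{n,i} the pair is the shift of the basic adjacent pair, whose commutation comes from
  -- SG_{n-i} through `phi`.
  obtain ⟨e, he, he'⟩ := Adj.exists_smul (i := i) (b := B.shift n ^ i) rfl rfl h1 h2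
    (tailBraids_le_D _ _ hc) (fun x hx => by
      rw [B.natPerm_shift_pow (by omega), add_comm x i, ec x hx])
  rw [he, he']
  apply commute_vertexElt_smul
  have hg : B.shift n ^ i * B.exchange n = (B.sigma n (2 + i) * B.sigma n (3 + i)
      * B.sigma n (1 + i) * B.sigma n (2 + i)) * B.shift n ^ i := by
    have s1 := B.shift_pow_mul_sigma (n := n) (j := 1) (k := i) (by omega) (by omega)
    have s2 := B.shift_pow_mul_sigma (n := n) (j := 2) (k := i) (by omega) (by omega)
    have s3 := B.shift_pow_mul_sigma (n := n) (j := 3) (k := i) (by omega) (by omega)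
    rw [← mul_inv_eq_iff_eq_mul] at s1 s2 s3
    rw [← s1, ← s2, ← s3, B.exchange]
    group
  have hφ : phi n i (B.toSG (n - i) (B.exchange (n - i)))
      = fromD hi (⟨B.sigma n (2 + i), sigma_mem_D (by omega)⟩
        * ⟨B.sigma n (3 + i), sigma_mem_D (by omega)⟩
        * ⟨B.sigma n (1 + i), sigma_mem_D (by omega)⟩
        * ⟨B.sigma n (2 + i), sigma_mem_D (by omega)⟩) := by
    rw [B.exchange]
    simp only [map_mul, B.toSG_sigma]
    rw [phi_sigma hi (by omega), phi_sigma hi (by omega), phi_sigma hi (by omega)]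
  have hcomm := (SG.zeta_commute_exchange (n := n - i) (by omega)).map (phi n i)
  rw [map_mul, map_mul, map_inv, hφ, ← repElt_of_not_le x hx, ← vertexElt_rep hi hn,
    ← vertexElt_braid hi hn, ex, smul_vtx] at hcomm
  rw [hg]
  exact hcomm

/-- A standard vertex on one of the first `i` strands and the vertex of the strands `k`, `k+1`. -/
theorem commute_shift_pow {x : Rep n i} (hx : x.1.2 ≤ i) {k : ℕ}
    (hk : (x.1.2 < i ∧ k = i) ∨ (x.1.2 = i ∧ k = i + 1)) (hkn : k + 1 < n) :
    Commute (vertexElt hi hn (vtx x.braid)) (vertexElt hi hn (vtx (B.shift n ^ k))) := by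
  have hadj := (adj_pairBraid (n := n) x.2.1 (by omega : x.1.2 < k) hkn).commute_toSG hi hn
  change Commute (Pres.toSG n i (vertexElt hi hn (vtx x.braid))) _ at hadj
  rw [vertexElt_braid] at hadj ⊢
  let t : Rep n i := ⟨(i, i + 1), by simp, by simp only; omega, Or.inr ⟨rfl, rfl⟩⟩
  have ht : ¬ t.1.2 ≤ i := by simp [t]
  have htb := (Rep.braid_of_not_le ht).2
  have hin : i + 1 < n := by omega
  have e : vertexElt hi hn (vtx (B.shift n ^ i))
      = fromD hi ⟨B.sigma n (i + 1), sigma_mem_D (by omega)⟩ * Pres.mk n i (tLetter hin) := by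
    rw [← htb, vertexElt_braid, repElt_of_not_le t ht, phi_zeta hi hin]
  -- By form 4 the generator of `x` commutes with σ_{k+1}. This factor can be split off from the
  -- second element, both here and in SG_n, leaving form 5 for k = i and form 7 for k = i + 1.
  rcases hk with ⟨hlt, rfl⟩ | ⟨heq, rfl⟩
  · have h1 := sigma_commute_repElt hi hx (j := k + 1) (by omega) ⟨by omega, hkn⟩
    have h2 : Commute (Pres.toSG n k (repElt x)) (Pres.toSG n k (Pres.mk n k (tLetter hin))) := by
      have := (h1.symm.map (Pres.toSG n k)).inv_right.mul_right hadj
      rwa [e, map_mul, inv_mul_cancel_left] at this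
    rw [e]
    refine h1.symm.mul_right ?_
    rw [repElt_of_le x hx] at h2 ⊢
    exact Pres.commute (.X_tau _ _ _ hin) h2
  · have h1 := sigma_commute_repElt hi hx (j := i + 2) (by omega) ⟨by omega, hkn⟩
    set s₁ : D n i := ⟨B.sigma n (i + 1), sigma_mem_D (by omega)⟩ with hs₁
    set s₂ : D n i := ⟨B.sigma n (i + 2), sigma_mem_D (by omega)⟩ with hs₂
    have hb : s₁ * s₂ * s₁ = s₂ * s₁ * s₂ :=
      Subtype.ext (B.sigma_braid (n := n) (j := i + 1) (by omega) hkn)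
    have hb' := congrArg (fromD hi) hb
    simp only [map_mul] at hb'
    -- The braid relation brings σ_{i+2} to the front; the remaining factor is exactly the conjugate
    -- of τ_{i+1} in form 7.
    have e' : vertexElt hi hn (vtx (B.shift n ^ (i + 1)))
        = fromD hi s₂ * (fromD hi s₁ * fromD hi s₂ * Pres.mk n i (tLetter hin)
          * (fromD hi s₂)⁻¹ * (fromD hi s₁)⁻¹) := by
      have h3 := vertexElt_smul hi hn (s₁ * s₂) (vtx (B.shift n ^ i))
      rw [vtx_shift_pow_succ (by omega)]
      rw [Subgroup.coe_mul, e, map_mul] at h3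
      rw [h3]
      simp only [← mul_assoc]
      rw [hb']
      group
    rw [e'] at hadj ⊢
    refine h1.symm.mul_right ?_
    have h2 := (h1.symm.map (Pres.toSG n i)).inv_right.mul_right hadj
    rw [map_mul _ (fromD hi s₂), inv_mul_cancel_left] at h2
    rw [hs₁, hs₂, fromD_sigma hi ⟨by omega, hin⟩, fromD_sigma hi ⟨by omega, hkn⟩,
      repElt_of_le x hx, ← map_inv, ← map_inv, ← map_mul, ← map_mul, ← map_mul, ← map_mul] at h2 ⊢
    exact Pres.commute (.X_tau_conj _ _ _ hkn) h2

/-- Only the first vertex involves one of the first `i` strands. -/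
theorem commute_le_tail {x y : Rep n i} (hx : x.1.2 ≤ i) (hy : ¬ y.1.2 ≤ i) {d d' : D n i}
    (h : Adj ((d : B n) • vtx x.braid) ((d' : B n) • vtx y.braid)) :
    Commute (vertexElt hi hn ((d : B n) • vtx x.braid))
      (vertexElt hi hn ((d' : B n) • vtx y.braid)) := by
  obtain ⟨b, h1, h2, h3, h4⟩ := h.exists_vtx
  have hn3 := h.1
  obtain ⟨hin, ey⟩ := Rep.braid_of_not_le hy
  have hlt := x.2.1
  have h1' := natPerm_of_vtx_eq hn (b' := (d : B n) * x.braid) h1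
  have h2' := natPerm_of_vtx_eq hn (b' := (d' : B n) * y.braid) h2
  simp only [map_mul, Equiv.Perm.mul_apply, Rep.braid, natPerm_pairBraid_zero x.2.1 x.2.2.1,
      natPerm_pairBraid_one x.2.1 x.2.2.1] at h1'
  simp only [map_mul, Equiv.Perm.mul_apply, ey, natPerm_exchange_zero hn3,
    natPerm_exchange_one hn3] at h2'
  rw [B.natPerm_shift_pow (by omega), B.natPerm_shift_pow (by omega), zero_add,
    add_comm 1 i] at h2'
  have e0 := mem_D.1 d.2 x.1.1 (by omega)
  have e3 := le_natPerm d'.2 (le_refl i)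
  have e4 := le_natPerm d'.2 (by omega : i ≤ i + 1)
  have l1 := B.natPerm_lt b (by omega : 1 < n)
  have l2 := B.natPerm_lt b (by omega : 2 < n)
  have l3 := B.natPerm_lt b hn3
  have n1 := (B.natPerm n b).injective.ne (show 1 ≠ 2 by omega)
  have n2 := (B.natPerm n b).injective.ne (show 1 ≠ 3 by omega)
  have hb2 : i ≤ B.natPerm n b 2 := by omega
  have hb3 : i ≤ B.natPerm n b 3 := by omega
  -- If both strands of `x` are below i, the other pair is modelled on i, i + 1. If `x` already uses
  -- the strand i, three free strands occur and the other pair is modelled on i + 1, i + 2.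
  obtain ⟨k, hk, hkn, c, hc, ec0, ec1, ec2, ec3⟩ : ∃ k,
      ((x.1.2 < i ∧ k = i) ∨ (x.1.2 = i ∧ k = i + 1)) ∧ k + 1 < n ∧
      ∃ c ∈ D n i, B.natPerm n c x.1.1 = B.natPerm n b 0 ∧
        B.natPerm n c x.1.2 = B.natPerm n b 1 ∧ B.natPerm n c k = B.natPerm n b 2 ∧
        B.natPerm n c (k + 1) = B.natPerm n b 3 := by
    rcases hx.lt_or_eq with hxi | hxi
    · have e1 := mem_D.1 d.2 x.1.2 hxi
      obtain ⟨c, hc, ec⟩ := exists_tailBraids_apply_eq (n := n) 2 i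
        (fun y => B.natPerm n b (2 + y)) (fun y hy => by
          obtain rfl | rfl : y = 0 ∨ y = 1 := by omega
          · exact ⟨hb2, l2⟩
          · exact ⟨hb3, l3⟩)
        (fun y _ z _ hyz => by simpa using (B.natPerm n b).injective hyz)
      have hcD := mem_D.1 (tailBraids_le_D _ _ hc)
      refine ⟨i, Or.inl ⟨hxi, rfl⟩, hin, c, tailBraids_le_D _ _ hc, ?_, ?_, ec 0 (by omega),
        ec 1 (by omega)⟩
      · rw [hcD _ (by omega)]; omega
      · rw [hcD _ (by omega)]; omega
    · have e1 := le_natPerm d.2 hxi.ge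
      have hb1 : i ≤ B.natPerm n b 1 := by omega
      obtain ⟨c, hc, ec⟩ := exists_tailBraids_apply_eq (n := n) 3 i
        (fun y => B.natPerm n b (1 + y)) (fun y hy => by
          obtain rfl | rfl | rfl : y = 0 ∨ y = 1 ∨ y = 2 := by omega
          · exact ⟨hb1, l1⟩
          · exact ⟨hb2, l2⟩
          · exact ⟨hb3, l3⟩)
        (fun y _ z _ hyz => by simpa using (B.natPerm n b).injective hyz)
      have hcD := mem_D.1 (tailBraids_le_D _ _ hc)
      refine ⟨i + 1, Or.inr ⟨hxi, rfl⟩, by omega, c, tailBraids_le_D _ _ hc, ?_, ?_,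
        ec 1 (by omega), ec 2 (by omega)⟩
      · rw [hcD _ (by omega)]; omega
      · rw [hxi]; exact ec 0 (by omega)
  obtain ⟨b₀, h1₀, h2₀, h3₀, h4₀⟩ :=
    (adj_pairBraid (n := n) x.2.1 (by omega : x.1.2 < k) hkn).exists_vtx
  have q1 := natPerm_of_vtx_eq hn h1₀
  have q2 := natPerm_of_vtx_eq hn h2₀
  simp only [natPerm_pairBraid_zero x.2.1 x.2.2.1, natPerm_pairBraid_one x.2.1 x.2.2.1] at q1
  rw [map_mul, Equiv.Perm.mul_apply, Equiv.Perm.mul_apply, natPerm_exchange_zero hn3,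
    natPerm_exchange_one hn3, B.natPerm_shift_pow (by omega), B.natPerm_shift_pow (by omega),
    zero_add, add_comm 1 k] at q2
  have p0 : B.natPerm n b₀ 0 = x.1.1 := by omega
  have p1 : B.natPerm n b₀ 1 = x.1.2 := by omega
  have p2 : B.natPerm n b₀ 2 = k := by omega
  have p3 : B.natPerm n b₀ 3 = k + 1 := by omega
  obtain ⟨e, he, he'⟩ := Adj.exists_smul (i := i) h1₀ h2₀ h1 h2 hc (fun y hy => by
    obtain rfl | rfl | rfl | rfl : y = 0 ∨ y = 1 ∨ y = 2 ∨ y = 3 := by omega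
    · rw [p0, ec0]
    · rw [p1, ec1]
    · rw [p2, ec2]
    · rw [p3, ec3])
  rw [he, he']
  exact commute_vertexElt_smul hi hn (commute_shift_pow hi hn hx hk hkn)

/-- The case distinction is by how many of the two vertices use a strand below i. This is what makes
the map from the vertex group to the presented group well defined. -/
theorem Adj.commute_vertexElt {v v' : Vertex n} (h : Adj v v') :
    Commute (vertexElt hi hn v) (vertexElt hi hn v') := by
  obtain ⟨x, d, hd, rfl⟩ := exists_rep (i := i) hn v
  obtain ⟨y, d', hd', rfl⟩ := exists_rep (i := i) hn v'
  by_cases hx : x.1.2 ≤ i <;> by_cases hy : y.1.2 ≤ i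
  · exact commute_of_le hi hn (d := ⟨d, hd⟩) (d' := ⟨d', hd'⟩) hx hy h
  · exact commute_le_tail hi hn (d := ⟨d, hd⟩) (d' := ⟨d', hd'⟩) hx hy h
  · exact (commute_le_tail hi hn (d := ⟨d', hd'⟩) (d' := ⟨d, hd⟩) hy hx h.symm).symm
  · exact commute_tail_tail hi hn (d := ⟨d, hd⟩) (d' := ⟨d', hd'⟩) hx hy h

end Adjacent

/-! ### The semidirect product decomposition of `SG_n` -/

/-- The words of the relations between adjacent vertices. -/
def adjRel (n : ℕ) : Set (FreeGroup (Vertex n)) :=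
  {r | ∃ v v', Adj v v' ∧ r = commRel (FreeGroup.of v) (FreeGroup.of v')}

/-- The group generated by the vertices, in which adjacent vertices commute. -/
abbrev VertexGroup (n : ℕ) : Type := PresentedGroup (adjRel n)

section Decomposition

variable {n : ℕ}

/-- The homomorphism on `VertexGroup n` that is given on vertices. -/
def VertexGroup.lift {H : Type*} [Group H] (f : Vertex n → H)
    (hf : ∀ v v', Adj v v' → Commute (f v) (f v')) : VertexGroup n →* H :=
  PresentedGroup.toGroup (f := f) (by
    rintro _ ⟨v, v', h, rfl⟩
    rw [commRel, rel, map_mul, map_inv, map_mul, map_mul, FreeGroup.lift_apply_of,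
      FreeGroup.lift_apply_of, mul_inv_eq_one]
    exact hf v v' h)

/-- The element of `VertexGroup n` of a vertex. -/
def VertexGroup.of (v : Vertex n) : VertexGroup n := PresentedGroup.of v

theorem VertexGroup.lift_of {H : Type*} [Group H] (f : Vertex n → H)
    (hf : ∀ v v', Adj v v' → Commute (f v) (f v')) (v : Vertex n) :
    VertexGroup.lift f hf (VertexGroup.of v) = f v := PresentedGroup.toGroup.of _

theorem VertexGroup.commute_of {v v' : Vertex n} (h : Adj v v') :
    Commute (VertexGroup.of v) (VertexGroup.of v') := by
  have := PresentedGroup.one_of_mem (rels := adjRel n) ⟨v, v', h, rfl⟩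
  rw [commRel, rel, map_mul, map_inv, mul_inv_eq_one, map_mul, map_mul] at this
  exact this

theorem VertexGroup.hom_ext {H : Type*} [Group H] {f f' : VertexGroup n →* H}
    (h : ∀ v, f (VertexGroup.of v) = f' (VertexGroup.of v)) : f = f' :=
  PresentedGroup.ext h

/-- The action of a braid on `VertexGroup n`. -/
def VertexGroup.act (b : B n) : VertexGroup n →* VertexGroup n :=
  VertexGroup.lift (fun v => VertexGroup.of (b • v)) fun _ _ h => VertexGroup.commute_of (h.smul b)

theorem VertexGroup.act_of (b : B n) (v : Vertex n) :
    VertexGroup.act b (VertexGroup.of v) = VertexGroup.of (b • v) := VertexGroup.lift_of _ _ _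

instance : MulDistribMulAction (B n) (VertexGroup n) where
  smul b a := VertexGroup.act b a
  one_smul a := by
    have : VertexGroup.act (1 : B n) = MonoidHom.id _ :=
      VertexGroup.hom_ext fun v => by rw [VertexGroup.act_of, one_smul, MonoidHom.id_apply]
    exact DFunLike.congr_fun this a
  mul_smul b b' a := by
    have : VertexGroup.act (b * b') = (VertexGroup.act b).comp (VertexGroup.act b') :=
      VertexGroup.hom_ext fun v => by
        rw [MonoidHom.comp_apply, VertexGroup.act_of, VertexGroup.act_of, VertexGroup.act_of,
          mul_smul]
    exact DFunLike.congr_fun this a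
  smul_mul b a a' := map_mul (VertexGroup.act b) a a'
  smul_one b := map_one (VertexGroup.act b)

theorem VertexGroup.smul_of (b : B n) (v : Vertex n) :
    b • VertexGroup.of v = VertexGroup.of (b • v) := VertexGroup.act_of b v

/-- The semidirect product of the vertex group and the braid group. -/
abbrev SemiProd (n : ℕ) : Type :=
  VertexGroup n ⋊[MulDistribMulAction.toMulAut (B n) (VertexGroup n)] B n

theorem SemiProd.inr_mul_inl (b : B n) (a : VertexGroup n) :
    (SemidirectProduct.inr b * SemidirectProduct.inl a : SemiProd n)
      = SemidirectProduct.inl (b • a) * SemidirectProduct.inr b := by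
  ext <;> simp

/-- The image of `τ_1` in the semidirect product. -/
def SemiProd.tau (n : ℕ) : SemiProd n :=
  (SemidirectProduct.inr (B.sigma n 1))⁻¹ * SemidirectProduct.inl (VertexGroup.of (vtx 1))

theorem SemiProd.commute_inl {c : B n} (hc : c ∈ tauStab n) :
    Commute (SemidirectProduct.inr c : SemiProd n)
      (SemidirectProduct.inl (VertexGroup.of (vtx 1))) := by
  rw [commute_iff_eq, SemiProd.inr_mul_inl, VertexGroup.smul_of, smul_vtx, mul_one]
  have := vtx_mul_of_mem 1 hc
  rw [one_mul] at this
  rw [this]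

theorem SemiProd.commute_tau {c : B n} (hc : c ∈ tauStab n) :
    Commute (SemidirectProduct.inr c : SemiProd n) (SemiProd.tau n) :=
  (((mem_tauStab.1 hc).1.map SemidirectProduct.inr).inv_right).mul_right
    (SemiProd.commute_inl hc)

/-- The argument of `SG.zeta_commute_exchange` in reverse: the vertices of 1 and of the exchange
commute by definition, and multiplying by σ_1⁻¹ gives the relation for the image of τ_1. -/
theorem SemiProd.exchange_tau (h : 3 < n) :
    (SemidirectProduct.inr (B.exchange n) : SemiProd n) * SemiProd.tau n
        * SemidirectProduct.inr (B.exchange n) * SemiProd.tau n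
      = SemiProd.tau n * SemidirectProduct.inr (B.exchange n) * SemiProd.tau n
        * SemidirectProduct.inr (B.exchange n) := by
  have e1 := congrArg (SemidirectProduct.inr : B n →* SemiProd n) (B.exchange_mul_sigma_one h)
  have e3 := congrArg (SemidirectProduct.inr : B n →* SemiProd n) (B.exchange_mul_sigma_three h)
  rw [map_mul, map_mul, ← mul_inv_eq_iff_eq_mul] at e1 e3
  rw [← commute_conj_iff]
  · apply commute_mul_conj (s' := (SemidirectProduct.inr (B.sigma n 3))⁻¹)
    · exact (SemiProd.commute_inl (sigma_mem_tauStab (by omega))).inv_left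
    · exact ((B.sigma_comm (by omega)).map SemidirectProduct.inr).inv_inv
    · rw [← e1]; group
    · rw [← e3]; group
    · have e : (SemidirectProduct.inr (B.exchange n) : SemiProd n)
          * SemidirectProduct.inl (VertexGroup.of (vtx 1))
          * (SemidirectProduct.inr (B.exchange n))⁻¹
          = SemidirectProduct.inl (VertexGroup.of (vtx (B.exchange n))) := by
        rw [SemiProd.inr_mul_inl, mul_inv_cancel_right, VertexGroup.smul_of, smul_vtx, mul_one]
      rw [e]
      refine (VertexGroup.commute_of ⟨h, 1, rfl, ?_⟩).map SemidirectProduct.inl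
      rw [one_mul]
  · rw [← map_pow]
    exact SemiProd.commute_tau (exchange_sq_mem_tauStab h)

/-- The homomorphism from `SG_n` to the semidirect product. -/
def SG.toSemiProd (n : ℕ) : SG n →* SemiProd n :=
  PresentedGroup.toGroup (f := fun x => match x with
    | .sigma j _ => SemidirectProduct.inr (B.sigma n j)
    | .tau _ => SemiProd.tau n) (by
    have hw : ∀ j, 1 ≤ j → j < n → FreeGroup.lift (fun x : SingGen n => match x with
        | .sigma j _ => (SemidirectProduct.inr (B.sigma n j) : SemiProd n)
        | .tau _ => SemiProd.tau n) (SingGen.word n j)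
          = SemidirectProduct.inr (B.sigma n j) := by
      intro j h₁ h₂
      rw [SingGen.word, dif_pos ⟨h₁, h₂⟩, FreeGroup.lift_apply_of]
    have ht : 1 < n → FreeGroup.lift (fun x : SingGen n => match x with
        | .sigma j _ => (SemidirectProduct.inr (B.sigma n j) : SemiProd n)
        | .tau _ => SemiProd.tau n) (SingGen.tauWord n) = SemiProd.tau n := by
      intro h
      rw [SingGen.tauWord, dif_pos h, FreeGroup.lift_apply_of]
    rintro r (⟨j, h₁, h₂⟩ | ⟨j, k, h₁, h₂, h₃⟩ | ⟨h⟩ | ⟨j, h₁, h₂, h₃⟩ | ⟨h⟩)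
    · rw [rel, map_mul, map_inv, mul_inv_eq_one, map_mul, map_mul, map_mul, map_mul,
        hw j (by omega) (by omega), hw (j + 1) (by omega) (by omega)]
      simp only [← map_mul, B.sigma_braid h₁ h₂]
    · rw [rel, map_mul, map_inv, mul_inv_eq_one, map_mul, map_mul,
        hw j (by omega) (by omega), hw k (by omega) (by omega)]
      exact (B.sigma_comm h₂).map _
    · rw [rel, map_mul, map_inv, mul_inv_eq_one]
      have := (SemiProd.commute_tau (encircle_mem_tauStab h)).eq
      simp only [B.encircle, map_mul, map_pow] at this
      simp only [map_mul, map_pow]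
      rw [hw 1 le_rfl (by omega), hw 2 (by omega) h, ht (by omega), this]
      simp only [mul_assoc]
    · rw [rel, map_mul, map_inv, mul_inv_eq_one, map_mul, map_mul, hw j h₁ h₂, ht (by omega)]
      exact SemiProd.commute_tau (sigma_mem_tauStab h₃)
    · rw [rel, map_mul, map_inv, mul_inv_eq_one]
      have := SemiProd.exchange_tau h
      simp only [B.exchange, map_mul] at this
      simp only [map_mul]
      rw [hw 1 le_rfl (by omega), hw 2 (by omega) (by omega), hw 3 (by omega) h, ht (by omega)]
      simp only [mul_assoc] at this ⊢
      exact this)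

theorem SG.toSemiProd_toSG (b : B n) :
    SG.toSemiProd n (B.toSG n b) = SemidirectProduct.inr b := by
  have : (SG.toSemiProd n).comp (B.toSG n) = SemidirectProduct.inr := by
    apply MonoidHom.eq_of_eqOn_dense (B.closure_sigma n)
    rintro _ ⟨j, h₁, h₂, rfl⟩
    rw [MonoidHom.comp_apply, B.toSG_sigma, SG.sigma, SingGen.word, dif_pos ⟨h₁, h₂⟩]
    exact PresentedGroup.toGroup.of _
  exact DFunLike.congr_fun this b

theorem SG.toSemiProd_tau (h : 1 < n) : SG.toSemiProd n (SG.tau n 1) = SemiProd.tau n := by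
  rw [SG.tau, SingGen.tauWord, dif_pos h]
  exact PresentedGroup.toGroup.of _

/-- The image of τ_1 was chosen so that σ_1 τ_1 goes to the base vertex. Relations between
conjugates of σ_1 τ_1 in SG_n therefore already hold in the vertex group. -/
theorem SG.toSemiProd_conjZeta (h : 1 < n) (b : B n) :
    SG.toSemiProd n (conjZeta b) = SemidirectProduct.inl (VertexGroup.of (vtx b)) := by
  rw [conjZeta, map_mul, map_mul, map_inv, SG.toSemiProd_toSG, SG.zeta, map_mul,
    SG.toSemiProd_tau h, ← B.toSG_sigma, SG.toSemiProd_toSG, SemiProd.tau, mul_inv_cancel_left,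
    SemiProd.inr_mul_inl, mul_inv_cancel_right, VertexGroup.smul_of, smul_vtx, mul_one]

/-- Every element of `SG_n` is a product of conjugates of `σ_1 τ_1` and a braid. -/
theorem SG.exists_mul (s : SG n) :
    ∃ a ∈ Subgroup.closure (Set.range (conjZeta (n := n))), ∃ b : B n, s = a * B.toSG n b := by
  have hconj : ∀ b : B n, ∀ a ∈ Subgroup.closure (Set.range (conjZeta (n := n))),
      B.toSG n b * a * (B.toSG n b)⁻¹ ∈ Subgroup.closure (Set.range (conjZeta (n := n))) := by
    intro b a ha
    have : Subgroup.closure (Set.range (conjZeta (n := n)))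
        ≤ (Subgroup.closure (Set.range (conjZeta (n := n)))).comap
          (MulAut.conj (B.toSG n b)).toMonoidHom := by
      rw [Subgroup.closure_le]
      rintro _ ⟨c, rfl⟩
      refine Subgroup.subset_closure ⟨b * c, ?_⟩
      rw [conjZeta_mul]
      rfl
    exact this ha
  have hzeta : SG.zeta n ∈ Subgroup.closure (Set.range (conjZeta (n := n))) :=
    Subgroup.subset_closure ⟨1, by simp [conjZeta]⟩
  have hs : s ∈ Subgroup.closure (Set.range
      (PresentedGroup.of : SingGen n → PresentedGroup {r | SingRel n r})) := by
    rw [PresentedGroup.closure_range_of]; trivial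
  have step : ∀ g : SingGen n, ∃ a ∈ Subgroup.closure (Set.range (conjZeta (n := n))),
      ∃ b : B n, (PresentedGroup.of g : SG n) = a * B.toSG n b := by
    rintro (⟨j, h⟩ | ⟨h⟩)
    · refine ⟨1, one_mem _, B.sigma n j, ?_⟩
      rw [one_mul, B.toSG_sigma, SG.sigma, SingGen.word, dif_pos h]
      rfl
    · refine ⟨_, hconj (B.sigma n 1)⁻¹ _ hzeta, (B.sigma n 1)⁻¹, ?_⟩
      have : (PresentedGroup.of (.tau h) : SG n) = SG.tau n 1 := by
        rw [SG.tau, SingGen.tauWord, dif_pos h]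
        rfl
      rw [this, map_inv, B.toSG_sigma, SG.zeta]
      group
  induction hs using Subgroup.closure_induction with
  | mem _ hx => obtain ⟨g, rfl⟩ := hx; exact step g
  | one => exact ⟨1, one_mem _, 1, by simp⟩
  | mul x y _ _ hx hy =>
    obtain ⟨a, ha, b, rfl⟩ := hx
    obtain ⟨a', ha', b', rfl⟩ := hy
    exact ⟨_, mul_mem ha (hconj b a' ha'), b * b', by rw [map_mul]; group⟩
  | inv x _ hx =>
    obtain ⟨a, ha, b, rfl⟩ := hx
    exact ⟨_, hconj b⁻¹ _ (inv_mem ha), b⁻¹, by rw [map_inv]; group⟩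

end Decomposition

/-! ### Identification of the presented group with SGD_{n,i} -/

section Presentation

variable {n i : ℕ}

/-- The homomorphism from the vertex group to the presented group. -/
noncomputable def fromVertexGroup (hi : i < n) (hn : 1 < n) : VertexGroup n →* Pres n i :=
  VertexGroup.lift (vertexElt hi hn) fun _ _ h => h.commute_vertexElt hi hn

theorem fromVertexGroup_of (hi : i < n) (hn : 1 < n) (v : Vertex n) :
    fromVertexGroup hi hn (VertexGroup.of v) = vertexElt hi hn v := VertexGroup.lift_of _ _ _

/-- The semidirect product of the vertex group and `D_{n,i}`. -/
abbrev SemiProdD (n i : ℕ) : Type :=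
  VertexGroup n ⋊[(MulDistribMulAction.toMulAut (B n) (VertexGroup n)).comp (D n i).subtype] D n i

/-- The homomorphism from the semidirect product to the presented group. -/
noncomputable def fromSemiProdD (hi : i < n) (hn : 1 < n) : SemiProdD n i →* Pres n i :=
  SemidirectProduct.lift (fromVertexGroup hi hn) (fromD hi) fun d =>
    VertexGroup.hom_ext fun v => by
      change fromVertexGroup hi hn ((d : B n) • VertexGroup.of v)
        = fromD hi d * fromVertexGroup hi hn (VertexGroup.of v) * (fromD hi d)⁻¹
      rw [VertexGroup.smul_of, fromVertexGroup_of, fromVertexGroup_of, vertexElt_smul]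

/-- The braid letters come from D_{n,i} and the X_{k,j} from standard vertices. The letter τ_{i+1}
is obtained by cancelling σ_{i+1} in the element of the last standard vertex. -/
theorem fromSemiProdD_surjective (hi : i < n) (hn : 1 < n) :
    Function.Surjective (fromSemiProdD hi hn) := by
  rw [← MonoidHom.range_eq_top, eq_top_iff, ← PresentedGroup.closure_range_of,
    Subgroup.closure_le]
  have hD : ∀ d, fromD hi d ∈ (fromSemiProdD hi hn).range := fun d =>
    ⟨SemidirectProduct.inr d, SemidirectProduct.lift_inr _ _ _ _⟩
  have hV : ∀ x : Rep n i, repElt x ∈ (fromSemiProdD hi hn).range := fun x =>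
    ⟨SemidirectProduct.inl (VertexGroup.of (vtx x.braid)), by
      rw [fromSemiProdD, SemidirectProduct.lift_inl, fromVertexGroup_of, vertexElt_braid]⟩
  rintro _ ⟨d | ⟨k, j, h⟩ | h, rfl⟩
  · have := hD (evalD n i (FreeGroup.of d))
    rw [fromD_evalD, inclD, FreeGroup.map.of] at this
    exact this
  · obtain ⟨k, rfl⟩ : ∃ l, k = l + 1 := ⟨k - 1, by omega⟩
    let x : Rep n i := ⟨(k, j), by simp only; omega, by simp only; omega, Or.inl h.2.2⟩
    have := hV x
    rw [repElt_of_le x h.2.2] at this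
    exact this
  · let x : Rep n i := ⟨(i, i + 1), by simp, h, Or.inr ⟨rfl, rfl⟩⟩
    have := hV x
    rw [repElt_of_not_le x (by simp [x]), phi_zeta hi h, Subgroup.mul_mem_cancel_left _ (hD _)] at this
    exact this

/-- The presented group embeds into `SG_n`. -/
theorem Pres.toSG_injective (hi : i < n) (hn : 1 < n) : Function.Injective (Pres.toSG n i) := by
  -- With `h2` this says that the composite from V ⋊ D_{n,i} to V ⋊ B_n is the inclusion. An element
  -- of the kernel then has trivial components.
  have h1 : ((SG.toSemiProd n).comp (Pres.toSG n i)).comp (fromVertexGroup hi hn)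
      = SemidirectProduct.inl := by
    refine VertexGroup.hom_ext fun v => ?_
    obtain ⟨b, rfl⟩ := vtx_surjective v
    rw [MonoidHom.comp_apply, MonoidHom.comp_apply, fromVertexGroup_of, toSG_vertexElt,
      SG.toSemiProd_conjZeta hn]
  have h2 : ∀ d, SG.toSemiProd n (Pres.toSG n i (fromD hi d)) = SemidirectProduct.inr (d : B n) :=
    fun d => by rw [toSG_fromD, SG.toSemiProd_toSG]
  rw [injective_iff_map_eq_one]
  intro y hy
  obtain ⟨⟨a, d⟩, rfl⟩ := fromSemiProdD_surjective hi hn y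
  have h3 : fromSemiProdD hi hn ⟨a, d⟩ = fromVertexGroup hi hn a * fromD hi d := rfl
  have h4 := congrArg (SG.toSemiProd n) hy
  rw [h3, map_mul, map_mul, map_one, h2] at h4
  have h5 := DFunLike.congr_fun h1 a
  rw [MonoidHom.comp_apply, MonoidHom.comp_apply] at h5
  rw [h5] at h4
  have ha := congrArg SemidirectProduct.left h4
  have hd := congrArg SemidirectProduct.right h4
  simp only [SemidirectProduct.mul_left, SemidirectProduct.left_inl, SemidirectProduct.left_inr,
    map_one, mul_one, SemidirectProduct.one_left, SemidirectProduct.mul_right,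
    SemidirectProduct.right_inl, SemidirectProduct.right_inr, one_mul,
    SemidirectProduct.one_right] at ha hd
  rw [h3, ha, show d = 1 from Subtype.ext hd, map_one, map_one, mul_one]

theorem perm_conjZeta (hn : 1 < n) (b : B n) : SG.perm n (conjZeta b) = 1 := by
  rw [conjZeta, map_mul, map_mul, SG.perm_zeta hn, mul_one, ← map_mul, mul_inv_cancel, map_one]

/-- The image of the presented group in `SG_n` is `SGD_{n,i}`. -/
theorem Pres.range_toSG (hi : i < n) (hn : 1 < n) : (Pres.toSG n i).range = SGD n i := by
  apply le_antisymm
  · rintro _ ⟨y, rfl⟩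
    obtain ⟨⟨a, d⟩, rfl⟩ := fromSemiProdD_surjective hi hn y
    have h1 : ((SG.perm n).comp (Pres.toSG n i)).comp (fromVertexGroup hi hn) = 1 := by
      refine VertexGroup.hom_ext fun v => ?_
      obtain ⟨b, rfl⟩ := vtx_surjective v
      rw [MonoidHom.comp_apply, MonoidHom.comp_apply, fromVertexGroup_of, toSG_vertexElt,
        perm_conjZeta hn, MonoidHom.one_apply]
    have h3 : fromSemiProdD hi hn ⟨a, d⟩ = fromVertexGroup hi hn a * fromD hi d := rfl
    have h5 := DFunLike.congr_fun h1 a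
    rw [MonoidHom.comp_apply, MonoidHom.comp_apply, MonoidHom.one_apply] at h5
    rw [SGD, Subgroup.mem_comap, h3, map_mul, map_mul, h5, one_mul, toSG_fromD, SG.perm_toSG]
    exact d.2
  · intro s hs
    -- The factor `a` has trivial permutation, so membership of `s` in SGD_{n,i} means that `b` lies
    -- in D_{n,i}.
    obtain ⟨a, ha, b, rfl⟩ := SG.exists_mul s
    have ha1 : SG.perm n a = 1 := by
      have : Subgroup.closure (Set.range (conjZeta (n := n))) ≤ (SG.perm n).ker := by
        rw [Subgroup.closure_le]
        rintro _ ⟨b, rfl⟩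
        exact perm_conjZeta hn b
      exact this ha
    rw [SGD, Subgroup.mem_comap, map_mul, ha1, one_mul, SG.perm_toSG] at hs
    have h1 : Subgroup.closure (Set.range (conjZeta (n := n))) ≤ (Pres.toSG n i).range := by
      rw [Subgroup.closure_le]
      rintro _ ⟨b, rfl⟩
      exact ⟨vertexElt hi hn (vtx b), toSG_vertexElt hi hn b⟩
    exact mul_mem (h1 ha) ⟨fromD hi ⟨b, hs⟩, toSG_fromD hi _⟩

theorem Pres.exists_mulEquiv (hinj : Function.Injective (Pres.toSG n i))
    (hrange : (Pres.toSG n i).range = SGD n i) :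
    ∃ e : Pres n i ≃* SGD n i, ∀ g : SGDGen n i,
      ((e (PresentedGroup.of g) : SGD n i) : SG n) = g.toSG :=
  ⟨(MonoidHom.ofInjective hinj).trans (MulEquiv.subgroupCongr hrange), fun g => Pres.toSG_of g⟩

end Presentation

end SingularBraid

theorem mainTheorem7 (n i : ℕ) (hi : i < n) :
    ∃ R : Set (FreeGroup (SingularBraid.SGDGen n i)),
      (∀ r ∈ R, SingularBraid.RelatorForm n i r) ∧
      ∃ e : PresentedGroup R ≃* SingularBraid.SGD n i,
        ∀ g : SingularBraid.SGDGen n i,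
          ((e (PresentedGroup.of g) : SingularBraid.SGD n i) : SingularBraid.SG n) = g.toSG := by
  open SingularBraid in
  refine ⟨relators n i, fun r hr => hr.1, ?_⟩
  rcases Nat.lt_or_ge 1 n with hn | hn
  · exact Pres.exists_mulEquiv (Pres.toSG_injective hi hn) (Pres.range_toSG hi hn)
  -- On one strand there is no pair of strands to define a vertex, but there are no generators
  -- either, so both groups are trivial.
  · obtain ⟨rfl, rfl⟩ : n = 1 ∧ i = 0 := by omega
    have h1 : IsEmpty (SGDGen 1 0) := by
      refine ⟨?_⟩
      rintro ((⟨k, j, h⟩ | ⟨j, h⟩) | ⟨k, j, h⟩ | h) <;> omega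
    have h2 : IsEmpty (SingGen 1) := by
      refine ⟨?_⟩
      rintro (⟨j, h⟩ | h) <;> omega
    have h3 : Subsingleton (Pres 1 0) := QuotientGroup.mk_surjective.subsingleton
    have h4 : Subsingleton (SG 1) := QuotientGroup.mk_surjective.subsingleton
    exact Pres.exists_mulEquiv (Function.injective_of_subsingleton _) (Subsingleton.elim _ _)
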